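/- **Theorem (Soundness of mover logic).** Let $\vdash\Sigma$ be the verification judgment for program states defined below, relative to a declaration table $D$ and a mover specification $M$. If $\vdash\Sigma$, then no execution of $\Sigma$ under the preemptive semantics $\to$ reaches a wrong state. **Language.** Let $\mathit{Tid}=\{1,2,\dots\}$. A store is a function $\sigma:\mathit{Var}\to\mathit{Value}$. An action is a set $A\subseteq\mathit{Tid}\times\mathit{Store}\times\mathit{Store}$; it is *total* if for all $t,\sigma$ there is $\sigma'$ with $(t,\sigma,\sigma')\in A$. A conditional action $C=A_1\diamond A_2$ is a pair of actions with $A_1\cup A_2$ total. Statements are $$s ::= \mathtt{skip}\mid\mathtt{wrong}\mid A\mid s;s\mid \mathtt{if}\ C\ s\ \mathtt{else}\ s\mid\mathtt{while}\ C\ s\mid f()\mid\mathtt{yield}.$$ $D$ is a finite table of function declarations $\mathit{spec}\ f()\{s\}$ with distinct names, where $\mathit{spec}$ is either "$\mathbf{atomic}\ e\ \mathbf{requires}\ S\ \mathbf{ensures}\ Q$" or "$\mathbf{relies}\ R\ \mathbf{guarantees}\ G\ \mathbf{requires}\ S\ \mathbf{ensures}\ T$", with $S,T\subseteq\mathit{Tid}\times\mathit{Store}$,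 $Q,R,G\subseteq\mathit{Tid}\times\mathit{Store}\times\mathit{Store}$ and $e$ an effect. Evaluation contexts are $E::=\bullet\mid E;s$. Thread $t$ steps by - $E[\mathtt{skip};s]\cdot\sigma\to_t E[s]\cdot\sigma$; - $E[\mathtt{yield}]\cdot\sigma\to_t E[\mathtt{skip}]\cdot\sigma$; - $E[A]\cdot\sigma\to_t E[\mathtt{skip}]\cdot\sigma'$ if $(t,\sigma,\sigma')\in A$; - $E[\mathtt{if}\,(A_1\diamond A_2)\,s_1\,\mathtt{else}\,s_2]\cdot\sigma\to_t E[s_i]\cdot\sigma'$ if $(t,\sigma,\sigma')\in A_i$, $i\in\{1,2\}$; - $E[\mathtt{while}\,C\,s]\cdot\sigma\to_t E[\mathtt{if}\,C\,(s;\mathtt{while}\,C\,s)\,\mathtt{else}\,\mathtt{skip}]\cdot\sigma$; - $E[f()]\cdot\sigma\to_t E[s]\cdot\sigma$ if $f()\{s\}$ is declared in $D$. A state $\Sigma=s_1..s_n\cdot\sigma$ steps, $\Sigma\to\Sigma'$, when any one thread $t\in\{1,\dots,n\}$ replaces $s_t\cdot\sigma$ by $s_t'\cdot\sigma'$ with $s_t\cdot\sigma\to_t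 s_t'\cdot\sigma'$. $\Sigma$ is *wrong* if some $s_t=E[\mathtt{wrong}]$. **Effects.** The effects $\mathsf{Y},\mathsf{R},\mathsf{L},\mathsf{B},\mathsf{N},\mathsf{E}$ (yield, right, left, both, non mover, error) are ordered by $\mathsf Y\sqsubseteq\mathsf B\sqsubseteq\mathsf R,\mathsf L\sqsubseteq\mathsf N\sqsubseteq\mathsf E$, with join $\sqcup$. Sequential composition $e_1;e_2$ (row $e_1$, column $e_2$) and closure $e^*$ are $$\begin{array}{c|cccccc|c} ;&\mathsf Y&\mathsf B&\mathsf R&\mathsf L&\mathsf N&\mathsf E&e^*\\\hline \mathsf Y&\mathsf Y&\mathsf Y&\mathsf Y&\mathsf L&\mathsf L&\mathsf E&\mathsf Y\\ \mathsf B&\mathsf Y&\mathsf B&\mathsf R&\mathsf L&\mathsf N&\mathsf E&\mathsf B\\ \mathsf R&\mathsf R&\mathsf R&\mathsf R&\mathsf N&\mathsf N&\mathsf E&\mathsf R\\ \mathsf L&\mathsf Y&\mathsf L&\mathsf E&\mathsf L&\mathsf E&\mathsf E&\mathsf L\\ \mathsf N&\mathsf R&\mathsf N&\mathsf E&\mathsf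 N&\mathsf E&\mathsf E&\mathsf E\\ \mathsf E&\mathsf E&\mathsf E&\mathsf E&\mathsf E&\mathsf E&\mathsf E&\mathsf E\end{array}$$ **Mover specifications.** $M$ maps each action, thread and store to an effect $M(A,t,\sigma)\neq\mathsf Y$; put $M(A,P)=\bigsqcup_{(t,\_,\sigma)\in P}M(A,t,\sigma)$. $M$ is *valid* if for all threads $t\neq u$, all actions $A_1,A_2$ and all stores $\sigma,\sigma',\sigma''$: 1. if $M(A_1,t,\sigma)\sqsubseteq\mathsf R$, $(t,\sigma,\sigma')\in A_1$, $M(A_2,u,\sigma')\sqsubseteq\mathsf N$ and $(u,\sigma',\sigma'')\in A_2$, then there is $\sigma'''$ with $(u,\sigma,\sigma''')\in A_2$ and $(t,\sigma''',\sigma'')\in A_1$; 2. if $M(A_1,t,\sigma)\sqsubseteq\mathsf N$, $(t,\sigma,\sigma')\in A_1$, $M(A_2,u,\sigma')\sqsubseteq\mathsf L$ and $(u,\sigma',\sigma'')\in A_2$, then there is $\sigma'''$ with $(u,\sigma,\sigma''')\in A_2$ and $(t,\sigma''',\sigma'')\in A_1$; 3. if $M(A_1,t,\sigma)\sqsubseteq\mathsf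 N$ and $(t,\sigma,\sigma')\in A_1$, then $M(A_2,u,\sigma')=M(A_2,u,\sigma)$; 4. if $M(A_1,t,\sigma)\sqsubseteq\mathsf N$, $(t,\sigma,\sigma')\in A_1$, $M(A_2,u,\sigma)\sqsubseteq\mathsf L$ and $(u,\sigma,\sigma'')\in A_2$, then there is $\sigma'''$ with $(u,\sigma',\sigma''')\in A_2$ and $(t,\sigma'',\sigma''')\in A_1$. **Statement judgment.** Write $I=\{(t,\sigma,\sigma)\}$, $\mathit{Two}(S)=\{(t,\sigma,\sigma)\mid(t,\sigma)\in S\}$, $\mathit{Post}(P)=\{(t,\sigma)\mid(t,\_,\sigma)\in P\}$, $P;A=\{(t,\sigma,\sigma'')\mid\exists\sigma'.\,(t,\sigma,\sigma')\in P,\ (t,\sigma',\sigma'')\in A\}$, and $\mathit{Yield}(P,R)=\{(t,\sigma',\sigma')\mid\exists\sigma.\,(t,\_,\sigma)\in P,\ (t,\sigma,\sigma')\in R^*\}$, where $R^*$ is the reflexive-transitive closure for each fixed $t$; $\Rightarrow$ denotes inclusion. The judgment $R;G\vdash s:P\to Q\cdot e$ is the least relation such that - $R;G\vdash A:P\to(P;A)\cdot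 M(A,P)$ if $M(A,P)\sqsubseteq\mathsf L$ implies that $A$ is total; - $R;G\vdash s_1;s_2:P\to Q_2\cdot(e_1;e_2)$ if $R;G\vdash s_1:P\to Q_1\cdot e_1$ and $R;G\vdash s_2:Q_1\to Q_2\cdot e_2$; - $R;G\vdash\mathtt{if}\,(A_1\diamond A_2)\,s_1\,\mathtt{else}\,s_2:P\to Q\cdot(M(A_1,P);e_1)\sqcup(M(A_2,P);e_2)$ if $R;G\vdash s_i:(P;A_i)\to Q\cdot e_i$ for $i=1,2$; - $R;G\vdash\mathtt{while}\,(A_1\diamond A_2)\,s:P\to(P;A_2)\cdot e$ if $R;G\vdash s:(P;A_1)\to P\cdot e_1$, $e=(M(A_1,P);e_1)^*;M(A_2,P)$ and $e\not\sqsubseteq\mathsf L$; - $R;G\vdash\mathtt{skip}:P\to P\cdot\mathsf B$, and $R;G\vdash\mathtt{wrong}:\emptyset\to\emptyset\cdot\mathsf B$; - $R;G\vdash\mathtt{yield}:P\to\mathit{Yield}(P,R)\cdot\mathsf Y$ if $P\Rightarrow G$; - $R;G\vdash s:P\to Q\cdot e$ if $R_1;G_1\vdash s:P_1\to Q_1\cdot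 e_1$, $P\Rightarrow P_1$, $Q_1\Rightarrow Q$, $R\Rightarrow R_1$, $G_1\Rightarrow G$ and $e_1\sqsubseteq e$; - $R;G\vdash f():P\to(P;Q)\cdot e$ if $f$ is declared in $D$ as $\mathbf{atomic}\ e\ \mathbf{requires}\ S\ \mathbf{ensures}\ Q$ and $\mathit{Post}(P)\Rightarrow S$; - $R;G\vdash f():\mathit{Two}(S)\to\mathit{Two}(T)\cdot\mathsf R$ if $f$ is declared in $D$ as $\mathbf{relies}\ R\ \mathbf{guarantees}\ G\ \mathbf{requires}\ S\ \mathbf{ensures}\ T$. **Functions and states.** A declaration of $f$ with body $s$ is *verified* if either its specification is $\mathbf{atomic}\ e\ \mathbf{requires}\ S\ \mathbf{ensures}\ Q$, $f$ is not directly or indirectly recursive, and $\emptyset;\emptyset\vdash s:\mathit{Two}(S)\to Q\cdot e$; or its specification is $\mathbf{relies}\ R\ \mathbf{guarantees}\ G\ \mathbf{requires}\ S\ \mathbf{ensures}\ T$, $R;G\vdash s:\mathit{Two}(S)\to\mathit{Two}(T)\cdot\mathsf R$, and $G\neq\emptyset$. Finally, $\vdash s_1..s_n\cdot\sigma$ holds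 if every declaration in $D$ is verified, $M$ is valid, and there are $R,G$ and, for each thread $t\in\{1,\dots,n\}$, $P_t,Q_t,e_t$ such that $I\Rightarrow G$; for each thread $t$, $R;G\vdash s_t:P_t\to Q_t\cdot e_t$, $e_t\neq\mathsf E$, $Q_t\Rightarrow G$, $s_t$ is yielding (that is, $s_t=E[\mathtt{yield}]$ for some $E$) and $(t,\sigma,\sigma)\in P_t$; and for all threads $t\neq u$ and stores $\sigma_1,\sigma_2$, $(t,\sigma_1,\sigma_2)\in G$ implies $(u,\sigma_1,\sigma_2)\in R$. -/

import Mathlib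

namespace MoverLogic

/-! Effects -/

/-- Effects: yield, right mover, left mover, both mover, non mover, error. -/
inductive Effect : Type
  | Y | R | L | B | N | E
  deriving DecidableEq

namespace Effect

instance : Fintype Effect := ⟨{Y, R, L, B, N, E}, fun x => by cases x <;> decide⟩

/-- The order `Y ⊑ B ⊑ R, L ⊑ N ⊑ E`. -/
def le : Effect → Effect → Prop
  | Y, _ => True
  | B, Y => False
  | B, _ => True
  | R, R => True
  | R, N => True
  | R, E => True
  | R, _ => False
  | L, L => True
  | L, N => True
  | L, E => True
  | L, _ => False
  | N, N => True
  | N, E => True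
  | N, _ => False
  | E, E => True
  | E, _ => False

instance : LE Effect := ⟨le⟩

instance : DecidableRel (fun a b : Effect => a ≤ b) := fun a b => by
  change Decidable (le a b)
  cases a <;> cases b <;> (unfold le; infer_instance)

instance : PartialOrder Effect where
  le_refl := by decide
  le_trans := by decide
  le_antisymm := by decide

/-- Least upper bound of two effects. -/
def join : Effect → Effect → Effect
  | Y, e => e
  | e, Y => e
  | B, e => e
  | e, B => e
  | R, R => R
  | L, L => L
  | E, _ => E
  | _, E => E
  | _, _ => N

/-- Greatest lower bound of two effects. -/
def meet : Effect → Effect → Effect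
  | E, e => e
  | e, E => e
  | N, e => e
  | e, N => e
  | R, R => R
  | L, L => L
  | Y, _ => Y
  | _, Y => Y
  | _, _ => B

instance : Lattice Effect where
  sup := join
  inf := meet
  le_sup_left := by decide
  le_sup_right := by decide
  sup_le := by decide
  inf_le_left := by decide
  inf_le_right := by decide
  le_inf := by decide

instance : BoundedOrder Effect where
  top := E
  bot := Y
  le_top := by decide
  bot_le := by decide

noncomputable instance : CompleteLattice Effect := Fintype.toCompleteLattice Effect

/-- Sequential composition `e₁ ; e₂`. -/
def seq : Effect → Effect → Effect
  | Y, Y => Y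
  | Y, B => Y
  | Y, R => Y
  | Y, L => L
  | Y, N => L
  | Y, E => E
  | B, e => e
  | R, Y => R
  | R, B => R
  | R, R => R
  | R, L => N
  | R, N => N
  | R, E => E
  | L, Y => Y
  | L, B => L
  | L, R => E
  | L, L => L
  | L, N => E
  | L, E => E
  | N, Y => R
  | N, B => N
  | N, R => E
  | N, L => N
  | N, N => E
  | N, E => E
  | E, _ => E

/-- Iterative closure `e*`. -/
def star : Effect → Effect
  | Y => Y
  | B => B
  | R => R
  | L => L
  | N => E
  | E => E

end Effect

/-! Stores, actions, statements, declarations -/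

/-- Thread identifiers `1, 2, …`. -/
abbrev Tid : Type := ℕ+

/-- Stores map variables to values. -/
abbrev Store (Var Val : Type*) := Var → Val

/-- One-store predicates `S, T ⊆ Tid × Store`. -/
abbrev Pred1 (Var Val : Type*) := Set (Tid × Store Var Val)

/-- Two-store predicates `R, G, P, Q ⊆ Tid × Store × Store`, which are also the actions `A`. -/
abbrev Pred2 (Var Val : Type*) := Set (Tid × Store Var Val × Store Var Val)

/-- Every thread can perform the action from every store. -/
def Total {Var Val : Type*} (A : Pred2 Var Val) : Prop :=
  ∀ (t : Tid) (σ : Store Var Val), ∃ σ' : Store Var Val, (t, σ, σ') ∈ A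

/-- Conditional actions `A₁ ⋄ A₂`; at least one of the two cases is always enabled. -/
structure CondAction (Var Val : Type*) where
  onTrue : Pred2 Var Val
  onFalse : Pred2 Var Val
  total : Total (onTrue ∪ onFalse)

/-- Statements, over function names `F`. -/
inductive Stmt (F Var Val : Type*)
  | skip : Stmt F Var Val
  | wrong : Stmt F Var Val
  | action (A : Pred2 Var Val) : Stmt F Var Val
  | seq (s₁ s₂ : Stmt F Var Val) : Stmt F Var Val
  | ite (C : CondAction Var Val) (s₁ s₂ : Stmt F Var Val) : Stmt F Var Val
  | while (C : CondAction Var Val) (s : Stmt F Var Val) : Stmt F Var Val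
  | call (f : F) : Stmt F Var Val
  | yield : Stmt F Var Val

/-- The set of functions that a statement calls. -/
def Stmt.callees {F Var Val : Type*} : Stmt F Var Val → Set F
  | .skip => ∅
  | .wrong => ∅
  | .action _ => ∅
  | .seq s₁ s₂ => s₁.callees ∪ s₂.callees
  | .ite _ s₁ s₂ => s₁.callees ∪ s₂.callees
  | .while _ s => s.callees
  | .call f => {f}
  | .yield => ∅

/-- Function specifications. -/
inductive FnSpec (Var Val : Type*)
  /-- `atomic e requires S ensures Q` -/
  | atomic (e : Effect) (S : Pred1 Var Val) (Q : Pred2 Var Val) : FnSpec Var Val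
  /-- `relies R guarantees G requires S ensures T` -/
  | nonAtomic (R G : Pred2 Var Val) (S T : Pred1 Var Val) : FnSpec Var Val

/-- Function declarations `spec f() { body }`. -/
structure FnDecl (F Var Val : Type*) where
  spec : FnSpec Var Val
  name : F
  body : Stmt F Var Val

/-- Declaration tables: a finite list of function declarations, each function declared at most
once. -/
structure DeclTable (F Var Val : Type*) where
  fns : List (FnDecl F Var Val)
  nodup : (fns.map FnDecl.name).Nodup

/-! Standard preemptive semantics -/

/-- Evaluation contexts `E ::= • | E; s`. -/
inductive Ctx (F Var Val : Type*)
  | hole : Ctx F Var Val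
  | seq (E : Ctx F Var Val) (s : Stmt F Var Val) : Ctx F Var Val

/-- `E[s]`. -/
def Ctx.fill {F Var Val : Type*} : Ctx F Var Val → Stmt F Var Val → Stmt F Var Val
  | .hole, s => s
  | .seq E s', s => .seq (E.fill s) s'

/-- `s · σ →ₜ s' · σ'`. -/
inductive ThreadStep {F Var Val : Type*} (D : DeclTable F Var Val) (t : Tid) :
    Stmt F Var Val → Store Var Val → Stmt F Var Val → Store Var Val → Prop
  | seq (E : Ctx F Var Val) (s : Stmt F Var Val) (σ : Store Var Val) :
      ThreadStep D t (E.fill (.seq .skip s)) σ (E.fill s) σ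
  | yield (E : Ctx F Var Val) (σ : Store Var Val) :
      ThreadStep D t (E.fill .yield) σ (E.fill .skip) σ
  | action (E : Ctx F Var Val) (A : Pred2 Var Val) (σ σ' : Store Var Val)
      (h : (t, σ, σ') ∈ A) :
      ThreadStep D t (E.fill (.action A)) σ (E.fill .skip) σ'
  | iteTrue (E : Ctx F Var Val) (C : CondAction Var Val) (s₁ s₂ : Stmt F Var Val)
      (σ σ' : Store Var Val) (h : (t, σ, σ') ∈ C.onTrue) :
      ThreadStep D t (E.fill (.ite C s₁ s₂)) σ (E.fill s₁) σ'
  | iteFalse (E : Ctx F Var Val) (C : CondAction Var Val) (s₁ s₂ : Stmt F Var Val)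
      (σ σ' : Store Var Val) (h : (t, σ, σ') ∈ C.onFalse) :
      ThreadStep D t (E.fill (.ite C s₁ s₂)) σ (E.fill s₂) σ'
  | while (E : Ctx F Var Val) (C : CondAction Var Val) (s : Stmt F Var Val)
      (σ : Store Var Val) :
      ThreadStep D t (E.fill (.while C s)) σ
        (E.fill (.ite C (.seq s (.while C s)) .skip)) σ
  | call (E : Ctx F Var Val) (fn : FnDecl F Var Val) (σ : Store Var Val) (h : fn ∈ D.fns) :
      ThreadStep D t (E.fill (.call fn.name)) σ (E.fill fn.body) σ

/-- States `s₁..sₙ · σ`; the thread at index `i : Fin n` has identifier `i + 1`. -/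
structure State (F Var Val : Type*) (n : ℕ) where
  threads : Fin n → Stmt F Var Val
  store : Store Var Val

/-- The thread identifier in `{1, …, n}` at index `i`. -/
def tid {n : ℕ} (i : Fin n) : Tid := Nat.succPNat i

/-- `Σ → Σ'`: any one thread takes a step. -/
inductive Step {F Var Val : Type*} {n : ℕ} (D : DeclTable F Var Val) :
    State F Var Val n → State F Var Val n → Prop
  | thread (X : State F Var Val n) (i : Fin n) (s' : Stmt F Var Val) (σ' : Store Var Val)
      (h : ThreadStep D (tid i) (X.threads i) X.store s' σ') :
      Step D X ⟨Function.update X.threads i s', σ'⟩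

/-- Some thread is about to execute `wrong`. -/
def State.IsWrong {F Var Val : Type*} {n : ℕ} (X : State F Var Val n) : Prop :=
  ∃ (i : Fin n) (E : Ctx F Var Val), X.threads i = E.fill .wrong

/-- Some execution from the state reaches a wrong state. -/
def GoesWrong {F Var Val : Type*} {n : ℕ} (D : DeclTable F Var Val)
    (X : State F Var Val n) : Prop :=
  ∃ X₁ : State F Var Val n, Relation.ReflTransGen (Step D) X X₁ ∧ X₁.IsWrong

/-! Mover specifications -/

/-- Mover specifications `M : Action × Tid × Store → Effect \ {Y}`. -/
abbrev MoverSpec (Var Val : Type*) :=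
  Pred2 Var Val → Tid → Store Var Val → {e : Effect // e ≠ Effect.Y}

/-- `M(A, P)`, the join of all `M(A, t, σ)` with `(t, _, σ) ∈ P`. -/
noncomputable def MoverSpec.on {Var Val : Type*} (M : MoverSpec Var Val) (A P : Pred2 Var Val) :
    Effect :=
  sSup {e | ∃ (t : Tid) (σ₀ σ : Store Var Val), (t, σ₀, σ) ∈ P ∧ e = (M A t σ).1}

/-- Validity of a mover specification. -/
structure MoverSpec.Valid {Var Val : Type*} (M : MoverSpec Var Val) : Prop where
  /-- Right movers can be moved later. -/
  right : ∀ (t u : Tid), t ≠ u → ∀ (A₁ A₂ : Pred2 Var Val) (σ σ' σ'' : Store Var Val),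
    (M A₁ t σ).1 ≤ Effect.R → (t, σ, σ') ∈ A₁ →
    (M A₂ u σ').1 ≤ Effect.N → (u, σ', σ'') ∈ A₂ →
    ∃ σ''' : Store Var Val, (u, σ, σ''') ∈ A₂ ∧ (t, σ''', σ'') ∈ A₁
  /-- Left movers can be moved earlier. -/
  left : ∀ (t u : Tid), t ≠ u → ∀ (A₁ A₂ : Pred2 Var Val) (σ σ' σ'' : Store Var Val),
    (M A₁ t σ).1 ≤ Effect.N → (t, σ, σ') ∈ A₁ →
    (M A₂ u σ').1 ≤ Effect.L → (u, σ', σ'') ∈ A₂ →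
    ∃ σ''' : Store Var Val, (u, σ, σ''') ∈ A₂ ∧ (t, σ''', σ'') ∈ A₁
  /-- A step of one thread does not change the effect of an action of another thread. -/
  stable : ∀ (t u : Tid), t ≠ u → ∀ (A₁ A₂ : Pred2 Var Val) (σ σ' : Store Var Val),
    (M A₁ t σ).1 ≤ Effect.N → (t, σ, σ') ∈ A₁ →
    ∀ e : Effect, (M A₂ u σ).1 = e → (M A₂ u σ').1 = e
  /-- A step of one thread does not block a left mover of another thread. -/
  nonblocking : ∀ (t u : Tid), t ≠ u → ∀ (A₁ A₂ : Pred2 Var Val) (σ σ' σ'' : Store Var Val),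
    (M A₁ t σ).1 ≤ Effect.N → (t, σ, σ') ∈ A₁ →
    (M A₂ u σ).1 ≤ Effect.L → (u, σ, σ'') ∈ A₂ →
    ∃ σ''' : Store Var Val, (u, σ', σ''') ∈ A₂ ∧ (t, σ'', σ''') ∈ A₁

/-! The logic -/

/-- `Two(S)`. -/
def two {Var Val : Type*} (S : Pred1 Var Val) : Pred2 Var Val :=
  {p | (p.1, p.2.1) ∈ S ∧ p.2.2 = p.2.1}

/-- `Post(P)`. -/
def post {Var Val : Type*} (P : Pred2 Var Val) : Pred1 Var Val :=
  {p | ∃ σ₀ : Store Var Val, (p.1, σ₀, p.2) ∈ P}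

/-- The identity action `I`. -/
def idAction {Var Val : Type*} : Pred2 Var Val :=
  {p | p.2.2 = p.2.1}

/-- `P ; A`. -/
def comp {Var Val : Type*} (P A : Pred2 Var Val) : Pred2 Var Val :=
  {p | ∃ σ' : Store Var Val, (p.1, p.2.1, σ') ∈ P ∧ (p.1, σ', p.2.2) ∈ A}

/-- `Yield(P, R)`. -/
def yieldPost {Var Val : Type*} (P R : Pred2 Var Val) : Pred2 Var Val :=
  {p | p.2.2 = p.2.1 ∧ ∃ σ₀ σ : Store Var Val, (p.1, σ₀, σ) ∈ P ∧
    Relation.ReflTransGen (fun a b => (p.1, a, b) ∈ R) σ p.2.1}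

/-- The judgment `R; G ⊢ s : P → Q · e`. -/
inductive Judgment {F Var Val : Type*} (M : MoverSpec Var Val) (D : DeclTable F Var Val) :
    Pred2 Var Val → Pred2 Var Val → Stmt F Var Val → Pred2 Var Val → Pred2 Var Val →
      Effect → Prop
  | action (R G : Pred2 Var Val) (A P : Pred2 Var Val)
      (hT : M.on A P ≤ Effect.L → Total A) :
      Judgment M D R G (.action A) P (comp P A) (M.on A P)
  | seq (R G : Pred2 Var Val) (s₁ s₂ : Stmt F Var Val) (P Q₁ Q₂ : Pred2 Var Val)
      (e₁ e₂ : Effect)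
      (h₁ : Judgment M D R G s₁ P Q₁ e₁) (h₂ : Judgment M D R G s₂ Q₁ Q₂ e₂) :
      Judgment M D R G (.seq s₁ s₂) P Q₂ (e₁.seq e₂)
  | ite (R G : Pred2 Var Val) (C : CondAction Var Val) (s₁ s₂ : Stmt F Var Val)
      (P Q : Pred2 Var Val) (e₁ e₂ : Effect)
      (h₁ : Judgment M D R G s₁ (comp P C.onTrue) Q e₁)
      (h₂ : Judgment M D R G s₂ (comp P C.onFalse) Q e₂) :
      Judgment M D R G (.ite C s₁ s₂) P Q
        (((M.on C.onTrue P).seq e₁) ⊔ ((M.on C.onFalse P).seq e₂))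
  | while (R G : Pred2 Var Val) (C : CondAction Var Val) (s : Stmt F Var Val)
      (P : Pred2 Var Val) (e₁ e : Effect)
      (h₁ : Judgment M D R G s (comp P C.onTrue) P e₁)
      (he : e = (((M.on C.onTrue P).seq e₁).star).seq (M.on C.onFalse P))
      (hL : ¬ e ≤ Effect.L) :
      Judgment M D R G (.while C s) P (comp P C.onFalse) e
  | skip (R G P : Pred2 Var Val) :
      Judgment M D R G .skip P P Effect.B
  | wrong (R G : Pred2 Var Val) :
      Judgment M D R G .wrong ∅ ∅ Effect.B
  | conseq (R R₁ G G₁ : Pred2 Var Val) (s : Stmt F Var Val) (P P₁ Q Q₁ : Pred2 Var Val)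
      (e e₁ : Effect)
      (hP : P ⊆ P₁) (hQ : Q₁ ⊆ Q) (hR : R ⊆ R₁) (hG : G₁ ⊆ G) (he : e₁ ≤ e)
      (h : Judgment M D R₁ G₁ s P₁ Q₁ e₁) :
      Judgment M D R G s P Q e
  | yield (R G P : Pred2 Var Val) (hG : P ⊆ G) :
      Judgment M D R G .yield P (yieldPost P R) Effect.Y
  | callAtomic (R G P : Pred2 Var Val) (fn : FnDecl F Var Val) (e : Effect)
      (S : Pred1 Var Val) (Q : Pred2 Var Val)
      (hD : fn ∈ D.fns) (hspec : fn.spec = .atomic e S Q) (hS : post P ⊆ S) :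
      Judgment M D R G (.call fn.name) P (comp P Q) e
  | callNonAtomic (R G : Pred2 Var Val) (fn : FnDecl F Var Val) (S T : Pred1 Var Val)
      (hD : fn ∈ D.fns) (hspec : fn.spec = .nonAtomic R G S T) :
      Judgment M D R G (.call fn.name) (two S) (two T) Effect.R

/-- The body of the declared function `f` contains a call of `g`. -/
def Calls {F Var Val : Type*} (D : DeclTable F Var Val) (f g : F) : Prop :=
  ∃ fn ∈ D.fns, fn.name = f ∧ g ∈ fn.body.callees

/-- `f` calls itself, directly or indirectly. -/
def IsRecursive {F Var Val : Type*} (D : DeclTable F Var Val) (f : F) : Prop :=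
  Relation.TransGen (Calls D) f f

/-- The judgment `⊢ fn`. -/
inductive FnJudgment {F Var Val : Type*} (M : MoverSpec Var Val) (D : DeclTable F Var Val) :
    FnDecl F Var Val → Prop
  | atomic (f : F) (s : Stmt F Var Val) (e : Effect) (S : Pred1 Var Val) (Q : Pred2 Var Val)
      (hrec : ¬ IsRecursive D f) (h : Judgment M D ∅ ∅ s (two S) Q e) :
      FnJudgment M D ⟨.atomic e S Q, f, s⟩
  | nonAtomic (f : F) (s : Stmt F Var Val) (R G : Pred2 Var Val) (S T : Pred1 Var Val)
      (h : Judgment M D R G s (two S) (two T) Effect.R) (hG : G ≠ ∅) :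
      FnJudgment M D ⟨.nonAtomic R G S T, f, s⟩

/-- The statement is about to execute `yield`. -/
def Stmt.IsYielding {F Var Val : Type*} (s : Stmt F Var Val) : Prop :=
  ∃ E : Ctx F Var Val, s = E.fill .yield

/-- The judgment `⊢ Σ`. -/
inductive StateJudgment {F Var Val : Type*} {n : ℕ} (M : MoverSpec Var Val)
    (D : DeclTable F Var Val) : State F Var Val n → Prop
  | state (X : State F Var Val n) (R G : Pred2 Var Val) (P Q : Fin n → Pred2 Var Val)
      (e : Fin n → Effect)
      (hfn : ∀ fn ∈ D.fns, FnJudgment M D fn)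
      (hM : M.Valid)
      (hI : idAction ⊆ G)
      (hthread : ∀ i : Fin n,
        Judgment M D R G (X.threads i) (P i) (Q i) (e i) ∧ e i ≠ Effect.E ∧ Q i ⊆ G ∧
          (X.threads i).IsYielding ∧ (tid i, X.store, X.store) ∈ P i)
      (hRG : ∀ i j : Fin n, i ≠ j → ∀ σ σ' : Store Var Val,
        (tid i, σ, σ') ∈ G → (tid j, σ, σ') ∈ R) :
      StateJudgment M D X

end MoverLogic

/-!
Call an execution that starts with all threads at a yield (or terminated) a run. Lipton's reduction
regroups a run: within a transaction, the steps of one thread between two of its yields, the effects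
`R* N L*` allow the right movers before the commit point to be delayed past steps of other threads
and the left movers after it to be advanced, so that the whole transaction can be executed first.
Once the transaction is over, the guarantee of its thread and the rely of the others show that all
threads are at a yield again, and the rest of the run is a shorter run.

By induction on the length of the run, it remains to treat a transaction that never ends. If it has
committed, its remaining effects are at most `L`; such code cannot loop or block, so the thread can
be driven to its next yield by left movers, which leave the effects of the other threads unchanged.
If no transaction has committed, all steps so far are right movers and each thread is typed in the
store that it would see if its own transaction had been executed first.
-/

namespace MoverLogic

namespace Effect

theorem seq_assoc (a b c : Effect) : (a.seq b).seq c = a.seq (b.seq c) := by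
  cases a <;> cases b <;> cases c <;> rfl

theorem seq_both (a : Effect) : a.seq B = a := by
  cases a <;> rfl

theorem seq_mono {a a' b b' : Effect} (ha : a ≤ a') (hb : b ≤ b') : a.seq b ≤ a'.seq b' := by
  revert a a' b b'; decide

theorem both_le_of_ne_yield {a : Effect} (h : a ≠ Y) : B ≤ a := by
  revert a; decide

theorem le_nonMover_of_ne_error {a : Effect} (h : a ≠ E) : a ≤ N := by
  revert a; decide

theorem le_of_seq_le_left {a b c : Effect} (hc : L ≤ c) (h : a.seq b ≤ c) : a ≤ c := by
  revert a b c; decide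

theorem le_of_seq_le_right {a b c : Effect} (ha : B ≤ a) (h : a.seq b ≤ c) : b ≤ c :=
  (seq_mono ha le_rfl).trans h

theorem le_nonMover_of_yield_seq_le {a : Effect} (h : Y.seq a ≤ N) : a ≤ N := by
  revert a; decide

theorem le_leftMover_of_seq_le_nonMover {a b : Effect} (ha : ¬ a ≤ R) (h : a.seq b ≤ N) :
    b ≤ L := by
  revert a b; decide

theorem seq_le_star_seq (a b c : Effect) (h : ¬ ((a.seq b).star).seq c ≤ L) :
    a.seq (b.seq (((a.seq b).star).seq c)) ≤ ((a.seq b).star).seq c := by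
  revert a b c; decide

theorem le_star_seq (a b : Effect) (h : ¬ (a.star).seq b ≤ L) : b ≤ (a.star).seq b := by
  revert a b; decide

/-- Adjacent steps of different threads with these effects, in this order, can be exchanged: the
first is a right mover or the second a left mover, and neither is an error. -/
def Swappable (a b : Effect) : Prop :=
  a ≤ R ∧ b ≤ N ∨ a ≤ N ∧ b ≤ L

theorem Swappable.left_le {a b : Effect} (h : a.Swappable b) : a ≤ N :=
  h.elim (fun h => h.1.trans (by decide)) And.left

theorem Swappable.right_le {a b : Effect} (h : a.Swappable b) : b ≤ N :=
  h.elim And.right fun h => h.2.trans (by decide)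

theorem Swappable.mono_left {a a' b : Effect} (h : a.Swappable b) (ha : a' ≤ a) :
    a'.Swappable b :=
  h.imp (And.imp_left ha.trans) (And.imp_left ha.trans)

end Effect

variable {F Var Val : Type*} {n : ℕ}

section Labels

/-- Labels of thread steps: yields, the other steps that leave the store unchanged, and the actions
of action statements and conditionals. They separate the change of a statement in a step from the
change of the store. -/
inductive Label (Var Val : Type*)
  | yield : Label Var Val
  | silent : Label Var Val
  | act (A : Pred2 Var Val) : Label Var Val

variable {M : MoverSpec Var Val} {t u : Tid} {a b : Label Var Val} {σ₀ σ σ' σ'' : Store Var Val}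

/-- The effect of a label executed by thread `t` in the store `σ`. -/
def Label.eff (M : MoverSpec Var Val) (t : Tid) (σ : Store Var Val) : Label Var Val → Effect
  | .yield => Effect.Y
  | .silent => Effect.B
  | .act A => (M A t σ).1

/-- The store relation of a label executed by thread `t`. -/
def Label.Rel (t : Tid) (σ σ' : Store Var Val) : Label Var Val → Prop
  | .yield => σ' = σ
  | .silent => σ' = σ
  | .act A => (t, σ, σ') ∈ A

/-- The strongest postcondition of a label for the precondition `P`. After a yield the transaction
starts anew, and threads that satisfy the rely `R` may have run. -/
def Label.post (R P : Pred2 Var Val) : Label Var Val → Pred2 Var Val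
  | .yield => yieldPost P R
  | .silent => P
  | .act A => comp P A

theorem Label.both_le_eff (ha : a ≠ .yield) : Effect.B ≤ a.eff M t σ := by
  cases a with
  | yield => exact absurd rfl ha
  | silent => exact le_refl Effect.B
  | act A => exact Effect.both_le_of_ne_yield (M A t σ).2

theorem Label.mem_post {R P : Pred2 Var Val} (ha : a ≠ .yield) (hr : a.Rel t σ σ')
    (hP : (t, σ₀, σ) ∈ P) : (t, σ₀, σ') ∈ a.post R P := by
  cases a with
  | yield => exact absurd rfl ha
  | silent => cases hr; exact hP
  | act A => exact ⟨σ, hP, hr⟩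

theorem MoverSpec.Valid.eff_eq (hM : M.Valid) (htu : t ≠ u) (ha : a.eff M t σ ≤ Effect.N)
    (hr : a.Rel t σ σ') : b.eff M u σ' = b.eff M u σ := by
  cases a with
  | yield | silent => cases hr; rfl
  | act A =>
    cases b with
    | yield | silent => rfl
    | act B => exact hM.stable t u htu A B σ σ' ha hr _ rfl

theorem MoverSpec.Valid.swap (hM : M.Valid) (htu : t ≠ u) (hra : a.Rel t σ σ')
    (hrb : b.Rel u σ' σ'') (hab : (a.eff M t σ).Swappable (b.eff M u σ')) :
    ∃ τ, b.Rel u σ τ ∧ a.Rel t τ σ'' := by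
  cases a with
  | yield | silent => cases hra; exact ⟨σ'', hrb, rfl⟩
  | act A =>
    cases b with
    | yield | silent => cases hrb; exact ⟨σ, rfl, hra⟩
    | act B =>
      rcases hab with ⟨ha, hb⟩ | ⟨ha, hb⟩
      · exact hM.right t u htu A B σ σ' σ'' ha hra hb hrb
      · exact hM.left t u htu A B σ σ' σ'' ha hra hb hrb

theorem MoverSpec.Valid.diamond (hM : M.Valid) (htu : t ≠ u) (hra : a.Rel t σ σ')
    (hrb : b.Rel u σ σ'') (ha : a.eff M t σ ≤ Effect.N) (hb : b.eff M u σ ≤ Effect.L) :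
    ∃ τ, b.Rel u σ' τ ∧ a.Rel t σ'' τ := by
  cases a with
  | yield | silent => cases hra; exact ⟨σ'', hrb, rfl⟩
  | act A =>
    cases b with
    | yield | silent => cases hrb; exact ⟨σ', rfl, hra⟩
    | act B => exact hM.nonblocking t u htu A B σ σ' σ'' ha hra hb hrb

end Labels

section Statements

/-- The change of a statement in a thread step, by recursion on the statement instead of
decomposition into an evaluation context and a redex. -/
inductive StmtStep (D : DeclTable F Var Val) :
    Stmt F Var Val → Label Var Val → Stmt F Var Val → Prop
  | skipSeq (s : Stmt F Var Val) : StmtStep D (.seq .skip s) .silent s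
  | seq {s₁ s₁' : Stmt F Var Val} {a : Label Var Val} (h : StmtStep D s₁ a s₁')
      (s₂ : Stmt F Var Val) : StmtStep D (.seq s₁ s₂) a (.seq s₁' s₂)
  | yield : StmtStep D .yield .yield .skip
  | action (A : Pred2 Var Val) : StmtStep D (.action A) (.act A) .skip
  | iteTrue (C : CondAction Var Val) (s₁ s₂ : Stmt F Var Val) :
      StmtStep D (.ite C s₁ s₂) (.act C.onTrue) s₁
  | iteFalse (C : CondAction Var Val) (s₁ s₂ : Stmt F Var Val) :
      StmtStep D (.ite C s₁ s₂) (.act C.onFalse) s₂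
  | loop (C : CondAction Var Val) (s : Stmt F Var Val) :
      StmtStep D (.while C s) .silent (.ite C (.seq s (.while C s)) .skip)
  | call (fn : FnDecl F Var Val) (h : fn ∈ D.fns) : StmtStep D (.call fn.name) .silent fn.body

variable {D : DeclTable F Var Val} {s s' : Stmt F Var Val} {a : Label Var Val}

theorem StmtStep.fill (h : StmtStep D s a s') (E : Ctx F Var Val) :
    StmtStep D (E.fill s) a (E.fill s') := by
  induction E with
  | hole => exact h
  | seq E s₂ ih => exact ih.seq s₂

theorem ThreadStep.exists_stmtStep {t : Tid} {σ σ' : Store Var Val} :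
    ThreadStep D t s σ s' σ' → ∃ a, StmtStep D s a s' ∧ a.Rel t σ σ'
  | .seq E s _ => ⟨.silent, (StmtStep.skipSeq s).fill E, rfl⟩
  | .yield E _ => ⟨.yield, StmtStep.yield.fill E, rfl⟩
  | .action E A _ _ h => ⟨.act A, (StmtStep.action A).fill E, h⟩
  | .iteTrue E C s₁ s₂ _ _ h => ⟨.act C.onTrue, (StmtStep.iteTrue C s₁ s₂).fill E, h⟩
  | .iteFalse E C s₁ s₂ _ _ h => ⟨.act C.onFalse, (StmtStep.iteFalse C s₁ s₂).fill E, h⟩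
  | .while E C s _ => ⟨.silent, (StmtStep.loop C s).fill E, rfl⟩
  | .call E fn _ h => ⟨.silent, (StmtStep.call fn h).fill E, rfl⟩

theorem Stmt.isYielding_seq {s₁ s₂ : Stmt F Var Val} :
    (Stmt.seq s₁ s₂).IsYielding ↔ s₁.IsYielding := by
  constructor
  · rintro ⟨_ | ⟨E, s⟩, h⟩
    · cases h
    · cases h
      exact ⟨E, rfl⟩
  · rintro ⟨E, rfl⟩
    exact ⟨.seq E s₂, rfl⟩

theorem Stmt.isYielding_yield : (Stmt.yield : Stmt F Var Val).IsYielding :=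
  ⟨.hole, rfl⟩

theorem StmtStep.isYielding_iff (h : StmtStep D s a s') : s.IsYielding ↔ a = .yield := by
  induction h with
  | seq _ s₂ ih => rw [Stmt.isYielding_seq, ih]
  | yield => exact iff_of_true Stmt.isYielding_yield rfl
  | _ =>
    refine iff_of_false ?_ nofun
    rintro ⟨_ | ⟨_ | ⟨_, _⟩, _⟩, h⟩ <;> cases h

/-- The statement has terminated or is about to yield; a thread in this situation is between
transactions. -/
def Stmt.Idle (s : Stmt F Var Val) : Prop :=
  s = .skip ∨ s.IsYielding

theorem StmtStep.eq_yield_of_idle (h : StmtStep D s a s') (hs : s.Idle) : a = .yield := by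
  rcases hs with rfl | hs
  · cases h
  · exact h.isYielding_iff.mp hs

theorem StmtStep.ne_yield_of_not_idle (h : StmtStep D s a s') (hs : ¬ s.Idle) : a ≠ .yield :=
  fun ha => hs (.inr (h.isYielding_iff.mpr ha))

end Statements

section Predicates

variable {M : MoverSpec Var Val} {A A' P P' R R' : Pred2 Var Val} {S : Pred1 Var Val}

theorem comp_mono (h : P ⊆ P') : comp P A ⊆ comp P' A :=
  fun _ ⟨σ, hP, hA⟩ => ⟨σ, h hP, hA⟩

theorem comp_mono_right (h : A ⊆ A') : comp P A ⊆ comp P A' :=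
  fun _ ⟨σ, hP, hA⟩ => ⟨σ, hP, h hA⟩

theorem comp_assoc (P₀ P A : Pred2 Var Val) : comp (comp P₀ P) A = comp P₀ (comp P A) := by
  ext p
  constructor
  · rintro ⟨σ, ⟨τ, h₁, h₂⟩, h₃⟩
    exact ⟨τ, h₁, σ, h₂, h₃⟩
  · rintro ⟨τ, h₁, σ, h₂, h₃⟩
    exact ⟨σ, ⟨τ, h₁, h₂⟩, h₃⟩

theorem subset_comp_two (h : post P ⊆ S) : P ⊆ comp P (two S) :=
  fun p hp => ⟨p.2.2, hp, h ⟨p.2.1, hp⟩, rfl⟩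

theorem yieldPost_mono (hP : P ⊆ P') (hR : R ⊆ R') : yieldPost P R ⊆ yieldPost P' R' :=
  fun _ ⟨h, σ₀, σ, hσ, hsteps⟩ =>
    ⟨h, σ₀, σ, hP hσ, Relation.ReflTransGen.mono (fun _ _ h => hR h) _ _ hsteps⟩

theorem MoverSpec.le_on {t : Tid} {σ₀ σ : Store Var Val} (h : (t, σ₀, σ) ∈ P) :
    (M A t σ).1 ≤ M.on A P :=
  le_sSup (α := Effect) ⟨t, σ₀, σ, h, rfl⟩

theorem MoverSpec.on_mono (h : P ⊆ P') : M.on A P ≤ M.on A P' :=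
  sSup_le_sSup (α := Effect) fun _ ⟨t, σ₀, σ, hσ, he⟩ => ⟨t, σ₀, σ, h hσ, he⟩

theorem MoverSpec.on_comp_le (P₀ : Pred2 Var Val) : M.on A (comp P₀ P) ≤ M.on A P :=
  sSup_le_sSup (α := Effect) fun _ ⟨t, _, σ, ⟨σ₁, _, hσ⟩, he⟩ => ⟨t, σ₁, σ, hσ, he⟩

end Predicates

section Typing

/-- A syntax-directed form of `Judgment`: every rule includes consequence, loops carry an invariant
`I` and a bound `e₀` on the effect of the remaining iterations, and the body of an atomic function
is typed at each call. It is preserved by the steps of a thread, and can be inverted. -/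
inductive Typing (M : MoverSpec Var Val) (D : DeclTable F Var Val) (R G : Pred2 Var Val) :
    Stmt F Var Val → Pred2 Var Val → Pred2 Var Val → Effect → Prop
  | action {A P Q : Pred2 Var Val} {e : Effect} (he : M.on A P ≤ e)
      (hT : e ≤ Effect.L → Total A) (hQ : comp P A ⊆ Q) : Typing M D R G (.action A) P Q e
  | seq {s₁ s₂ : Stmt F Var Val} {P Q₁ Q : Pred2 Var Val} {e₁ e₂ e : Effect}
      (h₁ : Typing M D R G s₁ P Q₁ e₁) (h₂ : Typing M D R G s₂ Q₁ Q e₂)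
      (he : e₁.seq e₂ ≤ e) : Typing M D R G (.seq s₁ s₂) P Q e
  | ite {C : CondAction Var Val} {s₁ s₂ : Stmt F Var Val} {P Q : Pred2 Var Val}
      {e₁ e₂ e : Effect}
      (h₁ : Typing M D R G s₁ (comp P C.onTrue) Q e₁)
      (h₂ : Typing M D R G s₂ (comp P C.onFalse) Q e₂)
      (he₁ : (M.on C.onTrue P).seq e₁ ≤ e) (he₂ : (M.on C.onFalse P).seq e₂ ≤ e) :
      Typing M D R G (.ite C s₁ s₂) P Q e
  | loop {C : CondAction Var Val} {s : Stmt F Var Val} {P Q : Pred2 Var Val} {e : Effect}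
      (I : Pred2 Var Val) (e₁ e₀ : Effect) (h : Typing M D R G s (comp I C.onTrue) I e₁)
      (hP : P ⊆ I) (hQ : comp I C.onFalse ⊆ Q)
      (he₁ : (M.on C.onTrue I).seq (e₁.seq e₀) ≤ e₀) (he₂ : M.on C.onFalse I ≤ e₀)
      (hL : ¬ e₀ ≤ Effect.L) (he : e₀ ≤ e) : Typing M D R G (.while C s) P Q e
  | skip {P Q : Pred2 Var Val} {e : Effect} (hQ : P ⊆ Q) (he : Effect.B ≤ e) :
      Typing M D R G .skip P Q e
  | wrong {P Q : Pred2 Var Val} {e : Effect} (hP : P ⊆ ∅) : Typing M D R G .wrong P Q e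
  | yield {P Q : Pred2 Var Val} {e : Effect} (hG : P ⊆ G) (hQ : yieldPost P R ⊆ Q) :
      Typing M D R G .yield P Q e
  | callAtomic {fn : FnDecl F Var Val} {P Q : Pred2 Var Val} {e : Effect} (hD : fn ∈ D.fns)
      (h : Typing M D R G fn.body P Q e) : Typing M D R G (.call fn.name) P Q e
  | callNonAtomic {fn : FnDecl F Var Val} {R₁ G₁ : Pred2 Var Val} {S T : Pred1 Var Val}
      {P Q : Pred2 Var Val} {e : Effect} (hD : fn ∈ D.fns)
      (hspec : fn.spec = .nonAtomic R₁ G₁ S T) (hne : G₁ ≠ ∅) (hP : P ⊆ two S)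
      (hQ : two T ⊆ Q) (hR : R ⊆ R₁) (hG : G₁ ⊆ G) (he : Effect.R ≤ e) :
      Typing M D R G (.call fn.name) P Q e

variable {M : MoverSpec Var Val} {D : DeclTable F Var Val} {R R' G G' P P' Q Q' : Pred2 Var Val}
  {s s' : Stmt F Var Val} {e e' : Effect} {a : Label Var Val} {t : Tid} {σ₀ σ : Store Var Val}

theorem Typing.weaken (h : Typing M D R G s P Q e) (hR : R' ⊆ R) (hG : G ⊆ G') (hP : P' ⊆ P)
    (hQ : Q ⊆ Q') (he : e ≤ e') : Typing M D R' G' s P' Q' e' := by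
  induction h generalizing P' Q' e' with
  | action he' hT hQ' =>
    exact .action ((MoverSpec.on_mono hP).trans (he'.trans he)) (fun h => hT (he.trans h))
      ((comp_mono hP).trans (hQ'.trans hQ))
  | seq _ _ he' ih₁ ih₂ =>
    exact .seq (ih₁ hP subset_rfl le_rfl) (ih₂ subset_rfl hQ le_rfl) (he'.trans he)
  | ite _ _ he₁ he₂ ih₁ ih₂ =>
    exact .ite (ih₁ (comp_mono hP) hQ le_rfl) (ih₂ (comp_mono hP) hQ le_rfl)
      ((Effect.seq_mono (MoverSpec.on_mono hP) le_rfl).trans (he₁.trans he))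
      ((Effect.seq_mono (MoverSpec.on_mono hP) le_rfl).trans (he₂.trans he))
  | loop I e₁ e₀ _ hP' hQ' he₁ he₂ hL he' ih =>
    exact .loop I e₁ e₀ (ih subset_rfl subset_rfl le_rfl) (hP.trans hP') (hQ'.trans hQ) he₁ he₂ hL
      (he'.trans he)
  | skip hQ' he' => exact .skip (hP.trans (hQ'.trans hQ)) (he'.trans he)
  | wrong hP' => exact .wrong (hP.trans hP')
  | yield hG' hQ' =>
    exact .yield (hP.trans (hG'.trans hG)) ((yieldPost_mono hP hR).trans (hQ'.trans hQ))
  | callAtomic hD _ ih => exact .callAtomic hD (ih hP hQ he)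
  | callNonAtomic hD hspec hne hP' hQ' hR' hG' he' =>
    exact .callNonAtomic hD hspec hne (hP.trans hP') (hQ'.trans hQ) (hR.trans hR') (hG'.trans hG)
      (he'.trans he)

-- The guarantee `∅` rules out yields and calls of nonatomic functions, so that no rule of the
-- derivation mentions the rely or the start of the transaction.
theorem Typing.frame (h : Typing M D R ∅ s P Q e) (R' G' P₀ : Pred2 Var Val) :
    Typing M D R' G' s (comp P₀ P) (comp P₀ Q) e := by
  induction h with
  | action he hT hQ =>
    refine .action ((MoverSpec.on_comp_le P₀).trans he) hT ?_
    rw [comp_assoc]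
    exact comp_mono_right hQ
  | seq _ _ he ih₁ ih₂ => exact .seq ih₁ ih₂ he
  | ite _ _ he₁ he₂ ih₁ ih₂ =>
    rw [← comp_assoc] at ih₁ ih₂
    exact .ite ih₁ ih₂ ((Effect.seq_mono (MoverSpec.on_comp_le P₀) le_rfl).trans he₁)
      ((Effect.seq_mono (MoverSpec.on_comp_le P₀) le_rfl).trans he₂)
  | loop I e₁ e₀ _ hP hQ he₁ he₂ hL he ih =>
    rw [← comp_assoc] at ih
    refine .loop (comp P₀ I) e₁ e₀ ih (comp_mono_right hP) ?_
      ((Effect.seq_mono (MoverSpec.on_comp_le P₀) le_rfl).trans he₁)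
      ((MoverSpec.on_comp_le P₀).trans he₂) hL he
    rw [comp_assoc]
    exact comp_mono_right hQ
  | skip hQ he => exact .skip (comp_mono_right hQ) he
  | wrong hP => exact .wrong fun _ ⟨_, _, h⟩ => (hP h).elim
  | yield hG _ =>
    exact .yield (fun _ ⟨_, _, h⟩ => (hG h).elim) fun _ ⟨_, _, _, ⟨_, _, h⟩, _⟩ => (hG h).elim
  | callAtomic hD _ ih => exact .callAtomic hD ih
  | callNonAtomic _ _ hne _ _ _ hG _ => exact absurd (Set.subset_empty_iff.mp hG) hne

theorem Typing.of_fill {E : Ctx F Var Val} (h : Typing M D R G (E.fill s) P Q e) :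
    ∃ Q' e', Typing M D R G s P Q' e' := by
  induction E generalizing Q e with
  | hole => exact ⟨Q, e, h⟩
  | seq E s₂ ih => cases h with | seq h₁ _ _ => exact ih h₁

theorem Typing.subset_empty_of_wrong {E : Ctx F Var Val}
    (h : Typing M D R G (E.fill .wrong) P Q e) : P ⊆ ∅ := by
  obtain ⟨_, _, h⟩ := h.of_fill
  cases h with | wrong hP => exact hP

theorem Typing.subset_guarantee (h : Typing M D R G s P Q e) (hs : s.IsYielding) : P ⊆ G := by
  obtain ⟨E, rfl⟩ := hs
  obtain ⟨_, _, h⟩ := h.of_fill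
  cases h with | yield hG _ => exact hG

theorem Typing.unfold_while {C : CondAction Var Val} (h : Typing M D R G (.while C s) P Q e) :
    Typing M D R G (.ite C (.seq s (.while C s)) .skip) P Q e := by
  cases h with
  | loop I e₁ e₀ h hP hQ he₁ he₂ hL he =>
    have again : Typing M D R G (.while C s) I Q e₀ :=
      .loop I e₁ e₀ h subset_rfl hQ he₁ he₂ hL le_rfl
    have leave : Typing M D R G .skip (comp I C.onFalse) Q Effect.B := .skip hQ le_rfl
    refine Typing.weaken (.ite (.seq h again le_rfl) leave he₁ ?_)
      subset_rfl subset_rfl hP subset_rfl he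
    rwa [Effect.seq_both]

/-- The bodies of the nonatomic functions are typed by their specifications. -/
def BodiesTyped (M : MoverSpec Var Val) (D : DeclTable F Var Val) : Prop :=
  ∀ fn ∈ D.fns, ∀ R G S T, fn.spec = .nonAtomic R G S T →
    Typing M D R G fn.body (two S) (two T) Effect.R

theorem DeclTable.eq_of_name_eq (D : DeclTable F Var Val) {f g : FnDecl F Var Val}
    (hf : f ∈ D.fns) (hg : g ∈ D.fns) (h : f.name = g.name) : f = g :=
  List.inj_on_of_nodup_map D.nodup hf hg h

theorem Typing.body_of_call (hB : BodiesTyped M D) {f : F} (h : Typing M D R G (.call f) P Q e)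
    {fn : FnDecl F Var Val} (hD : fn ∈ D.fns) (hf : fn.name = f) :
    Typing M D R G fn.body P Q e := by
  cases h with
  | callAtomic hD' h =>
    rwa [D.eq_of_name_eq hD hD' hf]
  | callNonAtomic hD' hspec _ hP hQ hR hG he =>
    rw [D.eq_of_name_eq hD hD' hf]
    exact (hB _ hD' _ _ _ _ hspec).weaken hR hG hP hQ he

theorem Typing.step (hB : BodiesTyped M D) (h : Typing M D R G s P Q e) (hs : StmtStep D s a s')
    (hP : (t, σ₀, σ) ∈ P) :
    ∃ e', Typing M D R G s' (a.post R P) Q e' ∧ (a.eff M t σ).seq e' ≤ e := by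
  induction hs generalizing Q e with
  | skipSeq s =>
    cases h with
    | @seq _ _ _ _ _ _ e₂ _ h₁ h₂ he =>
      cases h₁ with
      | skip hQ hB =>
        exact ⟨e₂, h₂.weaken subset_rfl subset_rfl hQ subset_rfl le_rfl,
          (Effect.seq_mono hB le_rfl).trans he⟩
  | seq _ s₂ ih =>
    cases h with
    | seq h₁ h₂ he =>
      obtain ⟨e₁', h₁', he₁⟩ := ih h₁
      refine ⟨_, .seq h₁' h₂ le_rfl, ?_⟩
      rw [← Effect.seq_assoc]
      exact (Effect.seq_mono he₁ le_rfl).trans he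
  | yield =>
    cases h with
    | yield _ hQ => exact ⟨Effect.B, .skip hQ le_rfl, bot_le (α := Effect)⟩
  | action A =>
    cases h with
    | action he _ hQ =>
      refine ⟨Effect.B, .skip hQ le_rfl, ?_⟩
      rw [Effect.seq_both]
      exact (MoverSpec.le_on hP).trans he
  | iteTrue =>
    cases h with
    | ite h₁ _ he₁ _ =>
      exact ⟨_, h₁, (Effect.seq_mono (MoverSpec.le_on hP) le_rfl).trans he₁⟩
  | iteFalse =>
    cases h with
    | ite _ h₂ _ he₂ =>
      exact ⟨_, h₂, (Effect.seq_mono (MoverSpec.le_on hP) le_rfl).trans he₂⟩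
  | loop => exact ⟨e, h.unfold_while, le_rfl⟩
  | call fn hD => exact ⟨e, h.body_of_call hB hD rfl, le_rfl⟩

end Typing

section RunsToIdle

/-- Alone and from the store `σ`, thread `t` can run `s` by left movers up to its next yield or to
termination in a store that satisfies `T`. -/
inductive RunsToIdle (M : MoverSpec Var Val) (D : DeclTable F Var Val) (t : Tid)
    (T : Store Var Val → Prop) : Stmt F Var Val → Store Var Val → Prop
  | yields {s : Stmt F Var Val} {σ : Store Var Val} (hs : s.IsYielding) : RunsToIdle M D t T s σ
  | terminates {σ : Store Var Val} (hT : T σ) : RunsToIdle M D t T .skip σ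
  | step {s s' : Stmt F Var Val} {σ σ' : Store Var Val} {a : Label Var Val}
      (hs : StmtStep D s a s') (ha : a ≠ .yield) (hr : a.Rel t σ σ')
      (he : a.eff M t σ ≤ Effect.L) (h : RunsToIdle M D t T s' σ') : RunsToIdle M D t T s σ

variable {M : MoverSpec Var Val} {D : DeclTable F Var Val} {t : Tid}
  {T T' : Store Var Val → Prop} {s s₁ s₂ : Stmt F Var Val} {σ₀ σ : Store Var Val}

theorem RunsToIdle.imp (hT : ∀ σ, T σ → T' σ) (h : RunsToIdle M D t T s σ) :
    RunsToIdle M D t T' s σ := by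
  induction h with
  | yields hs => exact .yields hs
  | terminates h => exact .terminates (hT _ h)
  | step hs ha hr he _ ih => exact .step hs ha hr he ih

theorem RunsToIdle.seq (h₁ : RunsToIdle M D t T s₁ σ)
    (h₂ : ∀ σ', T σ' → RunsToIdle M D t T' s₂ σ') : RunsToIdle M D t T' (.seq s₁ s₂) σ := by
  induction h₁ with
  | yields hs => exact .yields (Stmt.isYielding_seq.mpr hs)
  | terminates hT =>
    exact .step (.skipSeq s₂) nofun rfl (by decide : Effect.B ≤ Effect.L) (h₂ _ hT)
  | step hs ha hr he _ ih => exact .step (hs.seq s₂) ha hr he ih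

theorem RunsToIdle.act {A P Q : Pred2 Var Val} {s' : Stmt F Var Val} {e e' : Effect}
    {σ' : Store Var Val} (hs : StmtStep D s (.act A) s') (hP : (t, σ₀, σ) ∈ P)
    (hA : (t, σ, σ') ∈ A) (he' : (M.on A P).seq e' ≤ e) (he : e ≤ Effect.L)
    (h : e' ≤ Effect.L → RunsToIdle M D t (fun τ => (t, σ₀, τ) ∈ Q ∧ Effect.B ≤ e') s' σ') :
    RunsToIdle M D t (fun τ => (t, σ₀, τ) ∈ Q ∧ Effect.B ≤ e) s σ := by
  have hB : Effect.B ≤ (M A t σ).1 := Effect.both_le_of_ne_yield (M A t σ).2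
  have hle : (M A t σ).1.seq e' ≤ e := (Effect.seq_mono (MoverSpec.le_on hP) le_rfl).trans he'
  have he'e : e' ≤ e := Effect.le_of_seq_le_right hB hle
  exact .step hs nofun hA (Effect.le_of_seq_le_left le_rfl (hle.trans he))
    ((h (he'e.trans he)).imp fun _ => And.imp_right fun h => h.trans he'e)

-- The conjunct `B ≤ e` carries the induction through sequences: since `Y; N = L`, the second part
-- has an effect at most `L` only if the first part does not have effect `Y`.
theorem Typing.runsToIdle {R G P Q : Pred2 Var Val} {e : Effect} (h : Typing M D R G s P Q e)
    (he : e ≤ Effect.L) (hP : (t, σ₀, σ) ∈ P) :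
    RunsToIdle M D t (fun τ => (t, σ₀, τ) ∈ Q ∧ Effect.B ≤ e) s σ := by
  induction h generalizing σ with
  | @action A P Q e hA hT hQ =>
    obtain ⟨σ', hσ'⟩ := hT he t σ
    refine .act (.action A) hP hσ' (e' := Effect.B) ?_ he fun _ =>
      .terminates ⟨hQ ⟨σ, hP, hσ'⟩, le_rfl⟩
    rwa [Effect.seq_both]
  | seq _ _ hle ih₁ ih₂ =>
    refine (ih₁ (Effect.le_of_seq_le_left le_rfl (hle.trans he)) hP).seq fun σ' ⟨hQ₁, hB⟩ => ?_
    have he₂ := Effect.le_of_seq_le_right hB hle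
    exact (ih₂ (he₂.trans he) hQ₁).imp fun _ => And.imp_right fun h => h.trans he₂
  | @ite C s₁ s₂ _ _ _ _ _ _ _ he₁ he₂ ih₁ ih₂ =>
    obtain ⟨σ', hσ' | hσ'⟩ := C.total t σ
    · exact .act (.iteTrue C s₁ s₂) hP hσ' he₁ he fun h => ih₁ h ⟨σ, hP, hσ'⟩
    · exact .act (.iteFalse C s₁ s₂) hP hσ' he₂ he fun h => ih₂ h ⟨σ, hP, hσ'⟩
  | loop _ _ _ _ _ _ _ _ hL hle => exact absurd (hle.trans he) hL
  | skip hQ hB => exact .terminates ⟨hQ hP, hB⟩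
  | wrong hP' => exact (hP' hP).elim
  | yield => exact .yields Stmt.isYielding_yield
  | @callAtomic fn _ _ _ hD _ ih =>
    exact .step (.call fn hD) nofun rfl (by decide : Effect.B ≤ Effect.L) (ih he hP)
  | callNonAtomic _ _ _ _ _ _ _ hle => exact absurd (hle.trans he) (by decide)

end RunsToIdle

section Verification

variable {M : MoverSpec Var Val} {D : DeclTable F Var Val} {R G P Q : Pred2 Var Val}
  {s : Stmt F Var Val} {S T : Pred1 Var Val} {e : Effect} {fn : FnDecl F Var Val}

theorem FnJudgment.of_atomic (h : FnJudgment M D fn) (hspec : fn.spec = .atomic e S Q) :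
    ¬ IsRecursive D fn.name ∧ Judgment M D ∅ ∅ fn.body (two S) Q e := by
  cases h with
  | atomic _ _ _ _ _ hrec h => cases hspec; exact ⟨hrec, h⟩
  | nonAtomic => cases hspec

theorem FnJudgment.of_nonAtomic (h : FnJudgment M D fn) (hspec : fn.spec = .nonAtomic R G S T) :
    G ≠ ∅ ∧ Judgment M D R G fn.body (two S) (two T) Effect.R := by
  cases h with
  | atomic => cases hspec
  | nonAtomic _ _ _ _ _ _ h hG => cases hspec; exact ⟨hG, h⟩

theorem Judgment.typing (h : Judgment M D R G s P Q e)
    (hatomic : ∀ fn ∈ D.fns, fn.name ∈ s.callees → ∀ e S Q, fn.spec = .atomic e S Q →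
      Typing M D ∅ ∅ fn.body (two S) Q e)
    (hnonAtomic : ∀ fn ∈ D.fns, ∀ R G S T, fn.spec = .nonAtomic R G S T → G ≠ ∅) :
    Typing M D R G s P Q e := by
  induction h with
  | action R G A P hT => exact .action le_rfl hT subset_rfl
  | seq R G s₁ s₂ P Q₁ Q₂ e₁ e₂ _ _ ih₁ ih₂ =>
    exact .seq (ih₁ fun fn hD h => hatomic fn hD (.inl h))
      (ih₂ fun fn hD h => hatomic fn hD (.inr h)) le_rfl
  | ite R G C s₁ s₂ P Q e₁ e₂ _ _ ih₁ ih₂ =>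
    exact .ite (ih₁ fun fn hD h => hatomic fn hD (.inl h))
      (ih₂ fun fn hD h => hatomic fn hD (.inr h)) le_sup_left le_sup_right
  | skip R G P => exact .skip subset_rfl le_rfl
  | wrong R G => exact .wrong subset_rfl
  | conseq R R₁ G G₁ s P P₁ Q Q₁ e e₁ hP hQ hR hG he _ ih =>
    exact (ih hatomic).weaken hR hG hP hQ he
  | yield R G P hG => exact .yield hG subset_rfl
  | callAtomic R G P fn e S Q hD hspec hS =>
    exact .callAtomic hD (((hatomic fn hD rfl e S Q hspec).frame R G P).weaken subset_rfl
      subset_rfl (subset_comp_two hS) subset_rfl le_rfl)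
  | callNonAtomic R G fn S T hD hspec =>
    exact .callNonAtomic hD hspec (hnonAtomic fn hD R G S T hspec) subset_rfl subset_rfl
      subset_rfl subset_rfl le_rfl
  | _ R G C s P e₁ e _ he hL ih =>
    subst he
    exact .loop P e₁ _ (ih hatomic) subset_rfl subset_rfl (Effect.seq_le_star_seq _ _ _ hL)
      (Effect.le_star_seq _ _ hL) hL le_rfl

theorem nonrecursive_induction {motive : FnDecl F Var Val → Prop}
    (h : ∀ fn ∈ D.fns, ¬ IsRecursive D fn.name →
      (∀ g ∈ D.fns, ¬ IsRecursive D g.name → Calls D fn.name g.name → motive g) → motive fn)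
    (hD : fn ∈ D.fns) (hrec : ¬ IsRecursive D fn.name) : motive fn := by
  let Nonrec := {fn : FnDecl F Var Val // fn ∈ D.fns ∧ ¬ IsRecursive D fn.name}
  let Below (g f : Nonrec) : Prop := Relation.TransGen (Calls D) f.1.name g.1.name
  have : Finite Nonrec := ((List.finite_toSet D.fns).subset fun _ h => h.1).to_subtype
  have : IsTrans Nonrec Below := ⟨fun _ _ _ hfg hgh => hgh.trans hfg⟩
  have : Std.Irrefl Below := ⟨fun f => f.2.2⟩
  have wf : WellFounded Below := Finite.wellFounded_of_trans_of_irrefl Below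
  exact wf.induction (C := fun f => motive f.1) ⟨fn, hD, hrec⟩ fun f ih =>
    h f.1 f.2.1 f.2.2 fun g hg hgrec hcall => ih ⟨g, hg, hgrec⟩ (.single hcall)

theorem typing_body_of_atomic (hfn : ∀ fn ∈ D.fns, FnJudgment M D fn) (hD : fn ∈ D.fns)
    (hspec : fn.spec = .atomic e S Q) : Typing M D ∅ ∅ fn.body (two S) Q e := by
  refine nonrecursive_induction (motive := fun fn => ∀ e S Q, fn.spec = .atomic e S Q →
    Typing M D ∅ ∅ fn.body (two S) Q e) (fun fn hD _ ih e S Q hspec => ?_) hD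
    ((hfn fn hD).of_atomic hspec).1 e S Q hspec
  exact ((hfn fn hD).of_atomic hspec).2.typing
    (fun g hg hcall e' S' Q' hspec' =>
      ih g hg ((hfn g hg).of_atomic hspec').1 ⟨fn, hD, rfl, hcall⟩ e' S' Q' hspec')
    fun g hg _ _ _ _ hspec' => ((hfn g hg).of_nonAtomic hspec').1

theorem Judgment.typing_of_fnJudgment (hfn : ∀ fn ∈ D.fns, FnJudgment M D fn)
    (h : Judgment M D R G s P Q e) : Typing M D R G s P Q e :=
  h.typing (fun _ hg _ _ _ _ hspec => typing_body_of_atomic hfn hg hspec)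
    fun g hg _ _ _ _ hspec => ((hfn g hg).of_nonAtomic hspec).1

theorem bodiesTyped_of_fnJudgment (hfn : ∀ fn ∈ D.fns, FnJudgment M D fn) : BodiesTyped M D :=
  fun fn hD _ _ _ _ hspec => ((hfn fn hD).of_nonAtomic hspec).2.typing_of_fnJudgment hfn

end Verification

section Threads

variable {M : MoverSpec Var Val} {D : DeclTable F Var Val} {R G : Pred2 Var Val} {t : Tid}
  {b : Effect} {s s' : Stmt F Var Val} {a : Label Var Val} {σ₀ σ σ' : Store Var Val}

/-- Thread `t` is in a transaction that started in the store `σ₀`, and its remaining effect is at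
most `b`: for `b = N` it may not have committed yet, for `b = L` it has. -/
def Running (M : MoverSpec Var Val) (D : DeclTable F Var Val) (R G : Pred2 Var Val) (t : Tid)
    (b : Effect) (σ₀ : Store Var Val) (s : Stmt F Var Val) (σ : Store Var Val) : Prop :=
  ∃ P, Typing M D R G s P G b ∧ (t, σ₀, σ) ∈ P

/-- Thread `t` is between transactions: the last one has left it at a yield or at its end, and since
then the store has changed according to its rely. -/
def Quiescent (M : MoverSpec Var Val) (D : DeclTable F Var Val) (R G : Pred2 Var Val) (t : Tid)
    (s : Stmt F Var Val) (σ : Store Var Val) : Prop :=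
  s.Idle ∧ ∃ σ₀ σ₁, Running M D R G t Effect.N σ₀ s σ₁ ∧
    Relation.ReflTransGen (fun σ σ' => (t, σ, σ') ∈ R) σ₁ σ

/-- Thread `t` is not about to go wrong or to execute an action with the error effect. -/
def ThreadSafe (M : MoverSpec Var Val) (D : DeclTable F Var Val) (t : Tid)
    (s : Stmt F Var Val) (σ : Store Var Val) : Prop :=
  (∀ E : Ctx F Var Val, s ≠ E.fill .wrong) ∧
    ∀ a s', StmtStep D s a s' → a.eff M t σ ≤ Effect.N

theorem Running.not_wrong (h : Running M D R G t b σ₀ s σ) (E : Ctx F Var Val) :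
    s ≠ E.fill .wrong := by
  rintro rfl
  obtain ⟨P, hty, hP⟩ := h
  exact hty.subset_empty_of_wrong hP

theorem Running.eff_le (hB : BodiesTyped M D) (hb : Effect.L ≤ b)
    (h : Running M D R G t b σ₀ s σ) (hs : StmtStep D s a s') : a.eff M t σ ≤ b := by
  obtain ⟨P, hty, hP⟩ := h
  obtain ⟨e', -, he'⟩ := hty.step hB hs hP
  exact Effect.le_of_seq_le_left hb he'

theorem Running.step (hB : BodiesTyped M D) (h : Running M D R G t b σ₀ s σ)
    (hs : StmtStep D s a s') (ha : a ≠ .yield) (hr : a.Rel t σ σ') :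
    Running M D R G t b σ₀ s' σ' := by
  obtain ⟨P, hty, hP⟩ := h
  obtain ⟨e', hty', he'⟩ := hty.step hB hs hP
  exact ⟨_, hty'.weaken subset_rfl subset_rfl subset_rfl subset_rfl
    (Effect.le_of_seq_le_right (Label.both_le_eff ha) he'), Label.mem_post ha hr hP⟩

theorem Running.commit (hB : BodiesTyped M D) (h : Running M D R G t Effect.N σ₀ s σ)
    (hs : StmtStep D s a s') (ha : a ≠ .yield) (hr : a.Rel t σ σ')
    (hR : ¬ a.eff M t σ ≤ Effect.R) : Running M D R G t Effect.L σ₀ s' σ' := by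
  obtain ⟨P, hty, hP⟩ := h
  obtain ⟨e', hty', he'⟩ := hty.step hB hs hP
  exact ⟨_, hty'.weaken subset_rfl subset_rfl subset_rfl subset_rfl
    (Effect.le_leftMover_of_seq_le_nonMover hR he'), Label.mem_post ha hr hP⟩

theorem Running.threadSafe (hB : BodiesTyped M D) (hL : Effect.L ≤ b) (hN : b ≤ Effect.N)
    (h : Running M D R G t b σ₀ s σ) : ThreadSafe M D t s σ :=
  ⟨h.not_wrong, fun _ _ hs => (h.eff_le hB hL hs).trans hN⟩

theorem Running.runsToIdle (h : Running M D R G t Effect.L σ₀ s σ) :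
    RunsToIdle M D t (fun _ => True) s σ := by
  obtain ⟨P, hty, hP⟩ := h
  exact (hty.runsToIdle le_rfl hP).imp fun _ _ => trivial

theorem Running.mem_guarantee (h : Running M D R G t b σ₀ s σ) (hs : s.Idle) : (t, σ₀, σ) ∈ G := by
  obtain ⟨P, hty, hP⟩ := h
  rcases hs with rfl | hs
  · cases hty with | skip hG _ => exact hG hP
  · exact hty.subset_guarantee hs hP

theorem Running.quiescent (hb : b ≤ Effect.N) (h : Running M D R G t b σ₀ s σ) (hs : s.Idle) :
    Quiescent M D R G t s σ := by
  obtain ⟨P, hty, hP⟩ := h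
  exact ⟨hs, σ₀, σ, ⟨P, hty.weaken subset_rfl subset_rfl subset_rfl subset_rfl hb, hP⟩, .refl⟩

theorem Quiescent.rely (h : Quiescent M D R G t s σ) (hR : (t, σ, σ') ∈ R) :
    Quiescent M D R G t s σ' := by
  obtain ⟨hs, σ₀, σ₁, hrun, hsteps⟩ := h
  exact ⟨hs, σ₀, σ₁, hrun, hsteps.tail hR⟩

theorem Quiescent.running (hB : BodiesTyped M D) (h : Quiescent M D R G t s σ)
    (hs : StmtStep D s a s') : Running M D R G t Effect.N σ s' σ := by
  obtain ⟨hidle, σ₀, σ₁, ⟨P, hty, hP⟩, hsteps⟩ := h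
  obtain rfl := hs.eq_yield_of_idle hidle
  obtain ⟨e', hty', he'⟩ := hty.step hB hs hP
  exact ⟨yieldPost P R, hty'.weaken subset_rfl subset_rfl subset_rfl subset_rfl
    (Effect.le_nonMover_of_yield_seq_le he'), rfl, σ₀, σ₁, hP, hsteps⟩

theorem Quiescent.threadSafe (h : Quiescent M D R G t s σ) : ThreadSafe M D t s σ := by
  obtain ⟨hidle, _, _, hrun, -⟩ := h
  refine ⟨hrun.not_wrong, fun a s' hs => ?_⟩
  rw [hs.eq_yield_of_idle hidle]
  exact bot_le (α := Effect)

theorem ThreadSafe.congr (h : ThreadSafe M D t s σ)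
    (heff : ∀ a : Label Var Val, a.eff M t σ' = a.eff M t σ) : ThreadSafe M D t s σ' :=
  ⟨h.1, fun a s' hs => (heff a).trans_le (h.2 a s' hs)⟩

end Threads

section States

variable {M : MoverSpec Var Val} {D : DeclTable F Var Val} {i c : Fin n} {a a' : Label Var Val}
  {b b' : Effect} {k m : ℕ} {X X' Y Z : State F Var Val n}

theorem tid_ne (h : i ≠ c) : tid i ≠ tid c :=
  fun htid => h (Fin.ext (Nat.succPNat_injective htid))

/-- A step of the thread at index `i` with label `a`. -/
structure StateStep (D : DeclTable F Var Val) (i : Fin n) (a : Label Var Val)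
    (X Y : State F Var Val n) : Prop where
  stmtStep : StmtStep D (X.threads i) a (Y.threads i)
  rel : a.Rel (tid i) X.store Y.store
  threads_eq : ∀ j ≠ i, Y.threads j = X.threads j

theorem StateStep.of_stmtStep {s : Stmt F Var Val} {σ : Store Var Val}
    (hs : StmtStep D (X.threads i) a s) (hr : a.Rel (tid i) X.store σ) :
    StateStep D i a X ⟨Function.update X.threads i s, σ⟩ where
  stmtStep := by simpa only [Function.update_self] using hs
  rel := hr
  threads_eq _ hj := Function.update_of_ne hj _ _

theorem StateStep.exists_of_stmtStep {s : Stmt F Var Val} {σ : Store Var Val}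
    (hs : StmtStep D (X.threads i) a s) (hr : a.Rel (tid i) X.store σ) :
    ∃ Y, StateStep D i a X Y ∧ Y.threads i = s ∧ Y.store = σ :=
  ⟨_, .of_stmtStep hs hr, Function.update_self .., rfl⟩

theorem StateStep.eff_eq (hM : M.Valid) (h : StateStep D i a X Y) (hic : i ≠ c)
    (ha : a.eff M (tid i) X.store ≤ Effect.N) :
    a'.eff M (tid c) Y.store = a'.eff M (tid c) X.store :=
  hM.eff_eq (tid_ne hic) ha h.rel

theorem StateStep.swap (hM : M.Valid) (hic : i ≠ c) (h : StateStep D i a X Y)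
    (h' : StateStep D c a' Y Z)
    (he : (a.eff M (tid i) X.store).Swappable (a'.eff M (tid c) X.store)) :
    ∃ Y', StateStep D c a' X Y' ∧ StateStep D i a Y' Z := by
  rw [← h.eff_eq hM hic he.left_le] at he
  obtain ⟨τ, hr', hr⟩ := hM.swap (tid_ne hic) h.rel h'.rel he
  obtain ⟨Y', hY', hthread, rfl⟩ :=
    StateStep.exists_of_stmtStep (h.threads_eq c hic.symm ▸ h'.stmtStep) hr'
  refine ⟨Y', hY', ?_, hr, fun j hj => ?_⟩
  · rw [hY'.threads_eq i hic, h'.threads_eq i hic]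
    exact h.stmtStep
  · rcases eq_or_ne j c with rfl | hjc
    · exact hthread.symm
    · rw [h'.threads_eq j hjc, h.threads_eq j hj, hY'.threads_eq j hjc]

theorem StateStep.diamond (hM : M.Valid) (hic : i ≠ c) (h : StateStep D i a X Y)
    (h' : StateStep D c a' X X') (he : a.eff M (tid i) X.store ≤ Effect.N)
    (he' : a'.eff M (tid c) X.store ≤ Effect.L) :
    ∃ Y', StateStep D c a' Y Y' ∧ StateStep D i a X' Y' := by
  obtain ⟨τ, hr', hr⟩ := hM.diamond (tid_ne hic) h.rel h'.rel he he'
  obtain ⟨Y', hY', hthread, rfl⟩ :=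
    StateStep.exists_of_stmtStep ((h.threads_eq c hic.symm).symm ▸ h'.stmtStep) hr'
  refine ⟨Y', hY', ?_, hr, fun j hj => ?_⟩
  · rw [hY'.threads_eq i hic, h'.threads_eq i hic]
    exact h.stmtStep
  · rcases eq_or_ne j c with rfl | hjc
    · exact hthread
    · rw [hY'.threads_eq j hjc, h.threads_eq j hj, h'.threads_eq j hjc]

/-- Executions of `k` steps. -/
inductive Exec (D : DeclTable F Var Val) : ℕ → State F Var Val n → State F Var Val n → Prop
  | refl (X : State F Var Val n) : Exec D 0 X X
  | cons {k : ℕ} {i : Fin n} {a : Label Var Val} {X Y Z : State F Var Val n}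
      (hs : StateStep D i a X Y) (h : Exec D k Y Z) : Exec D (k + 1) X Z

theorem exists_exec (h : Relation.ReflTransGen (Step D) X Y) : ∃ k, Exec D k X Y := by
  induction h using Relation.ReflTransGen.head_induction_on with
  | refl => exact ⟨0, .refl Y⟩
  | head hstep _ ih =>
    obtain ⟨k, hk⟩ := ih
    obtain ⟨i, s', σ', hstep⟩ := hstep
    obtain ⟨a, hs, hr⟩ := hstep.exists_stmtStep
    exact ⟨k + 1, .cons (.of_stmtStep hs hr) hk⟩

/-- Executions of `k` steps of effect at most `b`, none of which is a step of the thread at index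
`c`: these are steps of its environment. -/
inductive EnvExec (M : MoverSpec Var Val) (D : DeclTable F Var Val) (b : Effect) (c : Fin n) :
    ℕ → State F Var Val n → State F Var Val n → Prop
  | refl (X : State F Var Val n) : EnvExec M D b c 0 X X
  | snoc {k : ℕ} {i : Fin n} {a : Label Var Val} {X Y Z : State F Var Val n}
      (h : EnvExec M D b c k X Y) (hs : StateStep D i a Y Z) (hi : i ≠ c)
      (he : a.eff M (tid i) Y.store ≤ b) : EnvExec M D b c (k + 1) X Z

theorem EnvExec.mono (h : EnvExec M D b c k X Y) (hb : b ≤ b') : EnvExec M D b' c k X Y := by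
  induction h with
  | refl => exact .refl _
  | snoc _ hs hi he ih => exact .snoc ih hs hi (he.trans hb)

theorem EnvExec.append (h : EnvExec M D b c k X Y) (h' : Exec D m Y Z) : Exec D (k + m) X Z := by
  induction h generalizing m with
  | refl => rwa [Nat.zero_add]
  | snoc _ hs _ _ ih =>
    rw [Nat.add_right_comm, Nat.add_assoc]
    exact ih (.cons hs h')

theorem EnvExec.threads_eq (h : EnvExec M D b c k X Y) : Y.threads c = X.threads c := by
  induction h with
  | refl => rfl
  | snoc _ hs hi _ ih => rw [hs.threads_eq c hi.symm, ih]

theorem EnvExec.eff_eq (hM : M.Valid) (hb : b ≤ Effect.N) (h : EnvExec M D b c k X Y)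
    (a : Label Var Val) : a.eff M (tid c) Y.store = a.eff M (tid c) X.store := by
  induction h with
  | refl => rfl
  | snoc _ hs hi he ih => rw [hs.eff_eq hM hi (he.trans hb), ih]

theorem EnvExec.moveLeft (hM : M.Valid) (h : EnvExec M D b c k X Y) (hs : StateStep D c a Y Z)
    (hb : b.Swappable (a.eff M (tid c) X.store)) :
    ∃ X', StateStep D c a X X' ∧ EnvExec M D b c k X' Z := by
  induction h generalizing Z with
  | refl => exact ⟨Z, hs, .refl Z⟩
  | snoc h hs₁ hi he ih =>
    have heff := h.eff_eq hM hb.left_le a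
    obtain ⟨Y', hs', hs₁'⟩ := hs₁.swap hM hi hs (heff ▸ hb.mono_left he)
    obtain ⟨X', hX', hexec⟩ := ih hs' hb
    have haN := heff.trans_le hb.right_le
    exact ⟨X', hX', .snoc hexec hs₁' hi ((hs'.eff_eq hM hi.symm haN).trans_le he)⟩

theorem EnvExec.push (hM : M.Valid) (hb : b ≤ Effect.N) (h : EnvExec M D b c k X Y)
    (hs : StateStep D c a X X') (ha : a.eff M (tid c) X.store ≤ Effect.L) :
    ∃ Y', StateStep D c a Y Y' ∧ EnvExec M D b c k X' Y' := by
  induction h with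
  | refl => exact ⟨X', hs, .refl X'⟩
  | snoc h hs₁ hi he ih =>
    obtain ⟨Y', hs', hexec⟩ := ih hs ha
    rw [← h.eff_eq hM hb a] at ha
    obtain ⟨Z', hZ', hs₁'⟩ := hs₁.diamond hM hi hs' (he.trans hb) ha
    have haN := ha.trans (by decide : Effect.L ≤ Effect.N)
    exact ⟨Z', hZ', .snoc hexec hs₁' hi ((hs'.eff_eq hM hi.symm haN).trans_le he)⟩

end States

section Reduction

variable {M : MoverSpec Var Val} {D : DeclTable F Var Val} {R G : Pred2 Var Val} {i c : Fin n}
  {a : Label Var Val} {b : Effect} {j k m q : ℕ} {X W W' Y Z : State F Var Val n}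

/-- The guarantee of each thread implies the rely of every other thread. -/
def Compatible (n : ℕ) (R G : Pred2 Var Val) : Prop :=
  ∀ i j : Fin n, i ≠ j → ∀ σ σ', (tid i, σ, σ') ∈ G → (tid j, σ, σ') ∈ R

/-- All threads are between transactions. -/
def AllQuiescent (M : MoverSpec Var Val) (D : DeclTable F Var Val) (R G : Pred2 Var Val)
    (X : State F Var Val n) : Prop :=
  ∀ i, Quiescent M D R G (tid i) (X.threads i) X.store

/-- No thread is about to go wrong or to execute an action with the error effect. -/
def State.IsSafe (M : MoverSpec Var Val) (D : DeclTable F Var Val) (X : State F Var Val n) : Prop :=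
  ∀ i, ThreadSafe M D (tid i) (X.threads i) X.store

/-- The state `W` is reached from `X` by steps of the thread at index `c` that belong to a single
transaction, in which the thread still is. -/
structure InTransaction (M : MoverSpec Var Val) (D : DeclTable F Var Val) (R G : Pred2 Var Val)
    (b : Effect) (c : Fin n) (X W : State F Var Val n) : Prop where
  running : Running M D R G (tid c) b X.store (W.threads c) W.store
  threads_eq : ∀ i ≠ c, W.threads i = X.threads i

theorem InTransaction.step (hB : BodiesTyped M D) (h : InTransaction M D R G b c X W)
    (hs : StateStep D c a W W') (ha : a ≠ .yield) : InTransaction M D R G b c X W' :=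
  ⟨h.running.step hB hs.stmtStep ha hs.rel,
    fun i hi => (hs.threads_eq i hi).trans (h.threads_eq i hi)⟩

theorem InTransaction.commit (hB : BodiesTyped M D) (h : InTransaction M D R G Effect.N c X W)
    (hs : StateStep D c a W W') (ha : a ≠ .yield) (hR : ¬ a.eff M (tid c) W.store ≤ Effect.R) :
    InTransaction M D R G Effect.L c X W' :=
  ⟨h.running.commit hB hs.stmtStep ha hs.rel hR,
    fun i hi => (hs.threads_eq i hi).trans (h.threads_eq i hi)⟩

theorem InTransaction.allQuiescent (hRG : Compatible n R G) (hX : AllQuiescent M D R G X)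
    (hb : b ≤ Effect.N) (h : InTransaction M D R G b c X W) (hidle : (W.threads c).Idle) :
    AllQuiescent M D R G W := by
  intro i
  rcases eq_or_ne i c with rfl | hi
  · exact h.running.quiescent hb hidle
  · rw [h.threads_eq i hi]
    exact (hX i).rely (hRG c i hi.symm _ _ (h.running.mem_guarantee hidle))

theorem EnvExec.threadSafe (hM : M.Valid) (hb : b ≤ Effect.N) (h : EnvExec M D b c k X Y)
    (hX : ThreadSafe M D (tid c) (X.threads c) X.store) :
    ThreadSafe M D (tid c) (Y.threads c) Y.store :=
  h.threads_eq ▸ hX.congr (h.eff_eq hM hb)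

theorem StateStep.threadSafe_iff (hM : M.Valid) (h : StateStep D c a X Y) (hi : i ≠ c)
    (ha : a.eff M (tid c) X.store ≤ Effect.N) :
    ThreadSafe M D (tid i) (Y.threads i) Y.store ↔
      ThreadSafe M D (tid i) (X.threads i) X.store := by
  rw [h.threads_eq i hi]
  exact ⟨fun hY => hY.congr fun _ => (h.eff_eq hM hi.symm ha).symm,
    fun hX => hX.congr fun _ => h.eff_eq hM hi.symm ha⟩

/-- Executions of fewer than `k` steps from states in which all threads are between transactions
lead to safe states: the induction hypothesis of the reduction. -/
def SafeBelow (M : MoverSpec Var Val) (D : DeclTable F Var Val) (R G : Pred2 Var Val) (n k : ℕ) :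
    Prop :=
  ∀ m < k, ∀ X Y : State F Var Val n, AllQuiescent M D R G X → Exec D m X Y → Y.IsSafe M D

theorem threadSafe_of_runsToIdle (hB : BodiesTyped M D) (hM : M.Valid) (hRG : Compatible n R G)
    (hk : SafeBelow M D R G n k) (hX : AllQuiescent M D R G X) (hq : q < k)
    {s : Stmt F Var Val} {σ : Store Var Val}
    (hrun : RunsToIdle M D (tid c) (fun _ => True) s σ) (hs : W.threads c = s) (hσ : W.store = σ)
    (hW : InTransaction M D R G Effect.L c X W) (hY : EnvExec M D Effect.N c q W Y) (hi : i ≠ c) :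
    ThreadSafe M D (tid i) (Y.threads i) Y.store := by
  induction hrun generalizing W Y with
  | yields hyield =>
    have hidle : (W.threads c).Idle := .inr (hs ▸ hyield)
    exact hk q hq W Y (hW.allQuiescent hRG hX (by decide) hidle) (hY.append (.refl Y)) i
  | terminates =>
    exact hk q hq W Y (hW.allQuiescent hRG hX (by decide) (.inl hs)) (hY.append (.refl Y)) i
  | step hstep ha hr he _ ih =>
    subst hs hσ
    obtain ⟨W', hW', hs', hσ'⟩ := StateStep.exists_of_stmtStep hstep hr
    obtain ⟨Y', hstepY, hY'⟩ := hY.push hM le_rfl hW' he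
    rw [← hY.eff_eq hM le_rfl] at he
    exact (hstepY.threadSafe_iff hM hi (he.trans (by decide))).mp
      (ih hs' hσ' (hW.step hB hW' ha) hY')

theorem isSafe_of_committed (hB : BodiesTyped M D) (hM : M.Valid) (hRG : Compatible n R G)
    (hk : SafeBelow M D R G n k) (hX : AllQuiescent M D R G X) (hq : q < k)
    (hW : InTransaction M D R G Effect.L c X W) (hY : EnvExec M D Effect.N c q W Y) :
    Y.IsSafe M D := by
  intro i
  rcases eq_or_ne i c with rfl | hi
  · exact hY.threadSafe hM le_rfl (hW.running.threadSafe hB le_rfl (by decide))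
  · exact threadSafe_of_runsToIdle hB hM hRG hk hX hq hW.running.runsToIdle rfl rfl hW hY hi

theorem isSafe_of_exec_committed (hB : BodiesTyped M D) (hM : M.Valid) (hRG : Compatible n R G)
    (hk : SafeBelow M D R G n k) (hX : AllQuiescent M D R G X) (hqm : q + m < k)
    (hW : InTransaction M D R G Effect.L c X W) (hidle : ¬ (W.threads c).Idle)
    (hY : EnvExec M D Effect.N c q W Y) (hZ : Exec D m Y Z) : Z.IsSafe M D := by
  induction hZ generalizing q W with
  | refl => exact isSafe_of_committed hB hM hRG hk hX hqm hW hY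
  | @cons m i a Y Y' Z hs hZ ih =>
    rcases eq_or_ne i c with rfl | hi
    · have hstep : StmtStep D (W.threads i) a (Y'.threads i) := hY.threads_eq ▸ hs.stmtStep
      have hL := hW.running.eff_le hB le_rfl hstep
      obtain ⟨W', hs', hY'⟩ := hY.moveLeft hM hs (.inr ⟨le_rfl, hL⟩)
      have hW' := hW.step hB hs' (hstep.ne_yield_of_not_idle hidle)
      by_cases hidle' : (W'.threads i).Idle
      · exact hk _ (by omega) W' Z (hW'.allQuiescent hRG hX (by decide) hidle') (hY'.append hZ)
      · exact ih (by omega) hW' hidle' hY'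
    · have hsafe := isSafe_of_committed hB hM hRG hk hX (by omega) hW hY
      exact ih (by omega) hW hidle (hY.snoc hs hi ((hsafe i).2 _ _ hs.stmtStep))

/-- The thread at index `i` is still between transactions in `W`, or in a transaction that started
in `X` and has not committed. -/
def Active (M : MoverSpec Var Val) (D : DeclTable F Var Val) (R G : Pred2 Var Val)
    (i : Fin n) (X W : State F Var Val n) : Prop :=
  W = X ∨ InTransaction M D R G Effect.N i X W ∧ ¬ (W.threads i).Idle

theorem Active.threadSafe (hB : BodiesTyped M D) (hX : AllQuiescent M D R G X)
    (h : Active M D R G i X W) : ThreadSafe M D (tid i) (W.threads i) W.store := by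
  rcases h with rfl | ⟨h, -⟩
  · exact (hX i).threadSafe
  · exact h.running.threadSafe hB (by decide) le_rfl

theorem Active.step (hB : BodiesTyped M D) (hX : AllQuiescent M D R G X)
    (h : Active M D R G i X W) (hs : StateStep D i a W W') :
    InTransaction M D R G Effect.N i X W' := by
  rcases h with rfl | ⟨h, hidle⟩
  · obtain rfl := hs.stmtStep.eq_yield_of_idle (hX i).1
    have hstore : W'.store = W.store := hs.rel
    refine ⟨?_, hs.threads_eq⟩
    rw [hstore]
    exact (hX i).running hB hs.stmtStep
  · exact h.step hB hs (hs.stmtStep.ne_yield_of_not_idle hidle)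

theorem Active.commit (hB : BodiesTyped M D) (hX : AllQuiescent M D R G X)
    (h : Active M D R G i X W) (hs : StateStep D i a W W')
    (hR : ¬ a.eff M (tid i) W.store ≤ Effect.R) : InTransaction M D R G Effect.L i X W' := by
  rcases h with rfl | ⟨h, hidle⟩
  · refine absurd (le_of_eq_of_le ?_ (bot_le (α := Effect))) hR
    rw [hs.stmtStep.eq_yield_of_idle (hX i).1]
    rfl
  · exact h.commit hB hs (hs.stmtStep.ne_yield_of_not_idle hidle) hR

/-- In the execution of `j` steps from `X` to `Y`, no thread has committed: for each of them, the
execution can be reordered so that the thread runs first and all other threads run after it, by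
right movers. -/
def Uncommitted (M : MoverSpec Var Val) (D : DeclTable F Var Val) (R G : Pred2 Var Val)
    (j : ℕ) (X Y : State F Var Val n) : Prop :=
  ∀ i, ∃ W, ∃ q ≤ j, Active M D R G i X W ∧ EnvExec M D Effect.R i q W Y

theorem Uncommitted.refl (X : State F Var Val n) : Uncommitted M D R G 0 X X :=
  fun _ => ⟨X, 0, le_rfl, .inl rfl, .refl X⟩

theorem Uncommitted.isSafe (hB : BodiesTyped M D) (hM : M.Valid) (hX : AllQuiescent M D R G X)
    (h : Uncommitted M D R G j X Y) : Y.IsSafe M D := by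
  intro i
  obtain ⟨W, q, -, hW, hY⟩ := h i
  exact hY.threadSafe hM (by decide) (hW.threadSafe hB hX)

theorem Uncommitted.step (h : Uncommitted M D R G j X Y) (hs : StateStep D c a Y Z)
    (ha : a.eff M (tid c) Y.store ≤ Effect.R) (hq : q ≤ j) (hW : Active M D R G c X W)
    (hZ : EnvExec M D Effect.R c q W Z) : Uncommitted M D R G (j + 1) X Z := by
  intro i
  rcases eq_or_ne i c with rfl | hi
  · exact ⟨W, q, Nat.le_succ_of_le hq, hW, hZ⟩
  · obtain ⟨W', q', hq', hW', hY⟩ := h i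
    exact ⟨W', q' + 1, Nat.succ_le_succ hq', hW', hY.snoc hs hi.symm ha⟩

theorem isSafe_of_exec_uncommitted (hB : BodiesTyped M D) (hM : M.Valid) (hRG : Compatible n R G)
    (hX : AllQuiescent M D R G X) (hk : SafeBelow M D R G n (j + m))
    (h : Uncommitted M D R G j X Y) (hZ : Exec D m Y Z) : Z.IsSafe M D := by
  induction hZ generalizing j with
  | refl => exact h.isSafe hB hM hX
  | @cons m c a Y Y' Z hs hZ ih =>
    obtain ⟨W, q, hq, hW, hY⟩ := h c
    have heff := hY.eff_eq hM (by decide) a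
    have hN : a.eff M (tid c) W.store ≤ Effect.N :=
      heff ▸ (h.isSafe hB hM hX c).2 a _ hs.stmtStep
    obtain ⟨W', hs', hY'⟩ := hY.moveLeft hM hs (.inl ⟨le_rfl, hN⟩)
    have hW' := hW.step hB hX hs'
    by_cases hidle : (W'.threads c).Idle
    · exact hk _ (by omega) W' Z (hW'.allQuiescent hRG hX le_rfl hidle) (hY'.append hZ)
    by_cases hR : a.eff M (tid c) W.store ≤ Effect.R
    · refine ih ?_ (h.step hs (heff ▸ hR) hq (.inr ⟨hW', hidle⟩) hY')
      rwa [Nat.add_right_comm]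
    · exact isSafe_of_exec_committed hB hM hRG hk hX (by omega) (hW.commit hB hX hs' hR) hidle
        (hY'.mono (by decide)) hZ

theorem safeBelow (hB : BodiesTyped M D) (hM : M.Valid) (hRG : Compatible n R G) (k : ℕ) :
    SafeBelow M D R G n k := by
  induction k with
  | zero => exact fun m hm => absurd hm (Nat.not_lt_zero m)
  | succ k ih =>
    intro m hm X Y hX hY
    refine isSafe_of_exec_uncommitted hB hM hRG hX ?_ (Uncommitted.refl X) hY
    exact fun m' hm' => ih m' (by omega)

theorem Judgment.quiescent (hfn : ∀ fn ∈ D.fns, FnJudgment M D fn) {s : Stmt F Var Val}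
    {P Q : Pred2 Var Val} {e : Effect} {t : Tid} {σ : Store Var Val}
    (h : Judgment M D R G s P Q e) (he : e ≠ Effect.E) (hQ : Q ⊆ G) (hs : s.IsYielding)
    (hP : (t, σ, σ) ∈ P) : Quiescent M D R G t s σ :=
  ⟨.inr hs, σ, σ, ⟨P, (h.typing_of_fnJudgment hfn).weaken subset_rfl subset_rfl subset_rfl hQ
    (Effect.le_nonMover_of_ne_error he), hP⟩, .refl⟩

end Reduction

end MoverLogic

theorem theorem1_general {F Var Val : Type*} {n : ℕ}
    {M : MoverLogic.MoverSpec Var Val} {D : MoverLogic.DeclTable F Var Val}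
    {X Y : MoverLogic.State F Var Val n} {R G : MoverLogic.Pred2 Var Val}
    {P Q : Fin n → MoverLogic.Pred2 Var Val} {e : Fin n → MoverLogic.Effect}
    (hfn : ∀ fn ∈ D.fns, MoverLogic.FnJudgment M D fn) (hM : M.Valid)
    (hthread : ∀ i : Fin n,
      MoverLogic.Judgment M D R G (X.threads i) (P i) (Q i) (e i) ∧ e i ≠ MoverLogic.Effect.E ∧
        Q i ⊆ G ∧ (X.threads i).IsYielding ∧ (MoverLogic.tid i, X.store, X.store) ∈ P i)
    (hRG : MoverLogic.Compatible n R G) (hXY : Relation.ReflTransGen (MoverLogic.Step D) X Y) :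
    Y.IsSafe M D := by
  have hX : MoverLogic.AllQuiescent M D R G X := fun i =>
    have ⟨hty, he, hQ, hs, hP⟩ := hthread i
    hty.quiescent hfn he hQ hs hP
  obtain ⟨k, hk⟩ := MoverLogic.exists_exec hXY
  exact MoverLogic.safeBelow (MoverLogic.bodiesTyped_of_fnJudgment hfn) hM hRG (k + 1) k
    k.lt_succ_self X Y hX hk

theorem theorem1 {F Var Val : Type*} {n : ℕ}
    (M : MoverLogic.MoverSpec Var Val) (D : MoverLogic.DeclTable F Var Val)
    (X : MoverLogic.State F Var Val n) (h : MoverLogic.StateJudgment M D X) :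
    ¬ MoverLogic.GoesWrong D X := by
  rintro ⟨Y, hXY, i, E, hwrong⟩
  obtain ⟨R, G, P, Q, e, hfn, hM, -, hthread, hRG⟩ := h
  exact (theorem1_general hfn hM hthread hRG hXY i).1 E hwrong
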